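/- Let $Q(x,y)=x^{T}ax+x^{T}by+y^{T}cy$ be a quadratic form on $\mathbf Z^8=\mathbf Z^4\times\mathbf Z^4$, where $a,b,c\in\mathrm{Mat}_4(\mathbf Z)$ and $a,c$ are symmetric. Suppose that $Q$ is generic: $\det(ab)\neq 0$, and the matrix $\Delta:=4b^{-1}ab^{-T}c-I$ has four distinct eigenvalues in $\overline{\mathbf Q}$, none of which is $0$ or $-1$. For a prime $p$ let $\mathrm{Sp}_8(\mathbf Z/p\mathbf Z)$ be the group of block matrices $\begin{pmatrix}A&B\\C&D\end{pmatrix}$ ($4\times4$ blocks over $\mathbf Z/p\mathbf Z$) with $A^TC=C^TA$, $B^TD=D^TB$, $A^TD-C^TB=I$, and for $r\in(\mathbf Z/p\mathbf Z)^*$ define the dilate $\begin{pmatrix}A&B\\C&D\end{pmatrix}^{(r)}:=\begin{pmatrix}A&r^{-1}B\\rC&D\end{pmatrix}$. If $p\nmid\det b$, let $g\in\mathrm{Sp}_8(\mathbf Z/p\mathbf Z)$ be the reduction mod $p$ of $\begin{pmatrix}-2b^{-T}c&b^{-T}\\4ab^{-T}c-b&-2ab^{-T}\end{pmatrix}$,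 and let $\Gamma_p\le\mathrm{Sp}_8(\mathbf Z/p\mathbf Z)$ be the subgroup generated by the elements $(g^{(s)})^{-1}g^{(t)}$, $s,t\in(\mathbf Z/p\mathbf Z)^*$. Write $e_p(t)=e^{2\pi i t/p}$. A mod-$p$ Weil representation is a homomorphism $\rho:\mathrm{Sp}_8(\mathbf Z/p\mathbf Z)\to \mathrm U(\ell^2((\mathbf Z/p\mathbf Z)^4))$ for which there is a function $\xi:\mathrm{Sp}_8(\mathbf Z/p\mathbf Z)\to\{z\in\mathbf C:|z|=1\}$ such that, for all $f$ and $x$, - $\rho(s(E))f(x)=\xi(s(E))\,f(E^{-1}x)$ for $s(E)=\begin{pmatrix}E&0\\0&E^{-T}\end{pmatrix}$, $E$ invertible; - $\rho(J)f(x)=\xi(J)\,p^{2}\cdot p^{-4}\sum_{y\in(\mathbf Z/p\mathbf Z)^4}f(y)e_p(x^Ty)$ for $J=\begin{pmatrix}0&I\\-I&0\end{pmatrix}$; - $\rho(l(W))f(x)=\xi(l(W))\,e_p(-\tfrac12x^TWx)f(x)$ for $l(W)=\begin{pmatrix}I&0\\W&I\end{pmatrix}$, $W$ symmetric. Then there is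 $p_0$, depending only on $Q$, such that for every prime $p\ge p_0$ we have $p\nmid\det b$, a mod-$p$ Weil representation exists, and the following holds. Let $\rho$ be any mod-$p$ Weil representation, let $r\in(\mathbf Z/p\mathbf Z)^*$, and let $\tilde\rho(x):=\rho(x^{(r)})$. Then $\tilde\rho|_{\Gamma_p}$ has no nonzero invariant vector: if $f\in\ell^2((\mathbf Z/p\mathbf Z)^4)$ satisfies $\tilde\rho(\gamma)f=f$ for all $\gamma\in\Gamma_p$, then $f=0$. -/

import Mathlib

open Matrix

noncomputable section

namespace Sp8

/-- `Sp₈(R)`: the `8 × 8` matrices `g`, in `4 × 4` blocks, with `g J gᵀ = J`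
(equivalently `gᵀ J g = J`). -/
abbrev Sp (R : Type*) [CommRing R] := Matrix.symplecticGroup (Fin 4) R

section Elements

variable {R : Type*} [CommRing R]

theorem fromBlocks_mem {A B C D : Matrix (Fin 4) (Fin 4) R}
    (h₁ : Aᵀ * C = Cᵀ * A) (h₂ : Bᵀ * D = Dᵀ * B) (h₃ : Aᵀ * D - Cᵀ * B = 1) :
    fromBlocks A B C D ∈ Matrix.symplecticGroup (Fin 4) R :=
  SymplecticGroup.fromBlocks_mem_iff.2 ⟨h₁, h₂, h₃⟩

/-- The element `J = (0 I; -I 0)`. -/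
def J : Sp R := ⟨fromBlocks 0 1 (-1) 0, fromBlocks_mem (by simp) (by simp) (by simp)⟩

/-- The element `s(E) = (E 0; 0 E⁻ᵀ)` for invertible `E`. -/
def s (E : GL (Fin 4) R) : Sp R :=
  ⟨fromBlocks (E : Matrix (Fin 4) (Fin 4) R) 0 0 ((E⁻¹ : GL (Fin 4) R) : Matrix (Fin 4) (Fin 4) R)ᵀ,
    fromBlocks_mem (by simp) (by simp) (by
      rw [← Matrix.transpose_mul, ← Units.val_mul]; simp)⟩

/-- The element `l(W) = (I 0; W I)` for symmetric `W`. -/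
def l (W : Matrix (Fin 4) (Fin 4) R) (hW : W.IsSymm) : Sp R :=
  ⟨fromBlocks 1 0 W 1, fromBlocks_mem (by simp [hW.eq]) (by simp) (by simp)⟩

/-- Dilation by `r`, the homomorphism `(A B; C D) ↦ (A r⁻¹B; rC D)` from `Sp₈(R)` to itself. -/
def dilation (r : Rˣ) : Sp R →* Sp R where
  toFun g :=
    ⟨fromBlocks g.1.toBlocks₁₁ ((r⁻¹ : Rˣ) • g.1.toBlocks₁₂) (r • g.1.toBlocks₂₁) g.1.toBlocks₂₂, by
      have hg := g.2
      rw [← fromBlocks_toBlocks g.1, SymplecticGroup.fromBlocks_mem_iff] at hg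
      obtain ⟨h₁, h₂, h₃⟩ := hg
      exact fromBlocks_mem (by simp [h₁]) (by simp [h₂]) (by simp [h₃])⟩
  map_one' := by
    apply Subtype.ext
    have h : (1 : Sp R).1 = fromBlocks 1 0 0 1 := by
      rw [fromBlocks_one]; rfl
    simp only [h, toBlocks_fromBlocks₁₁, toBlocks_fromBlocks₁₂, toBlocks_fromBlocks₂₁,
      toBlocks_fromBlocks₂₂, smul_zero]
  map_mul' g h := by
    apply Subtype.ext
    have e : (g * h).1 = g.1 * h.1 := rfl
    change _ = fromBlocks _ _ _ _ * fromBlocks _ _ _ _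
    simp only [e]
    rw [fromBlocks_multiply]
    conv_lhs => rw [← fromBlocks_toBlocks g.1, ← fromBlocks_toBlocks h.1, fromBlocks_multiply]
    simp

/-- The symplectic element `(-2b⁻ᵀc  b⁻ᵀ; 4ab⁻ᵀc - b  -2ab⁻ᵀ)` of the form
`xᵀax + xᵀby + yᵀcy` over a ring in which `det b` is invertible. -/
def symplecticElement (a b c : Matrix (Fin 4) (Fin 4) R) (ha : a.IsSymm) (hc : c.IsSymm)
    (hb : IsUnit b.det) : Sp R :=
  ⟨fromBlocks (-(2 : R) • (b⁻¹ᵀ * c)) b⁻¹ᵀ ((4 : R) • (a * b⁻¹ᵀ * c) - b) (-(2 : R) • (a * b⁻¹ᵀ)), by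
    have hb₁ : b⁻¹ * b = 1 := nonsing_inv_mul b hb
    have hb₂ : bᵀ * b⁻¹ᵀ = 1 := by rw [← transpose_mul, hb₁, transpose_one]
    have e : ∀ m : Matrix (Fin 4) (Fin 4) R, bᵀ * (b⁻¹ᵀ * m) = m := fun m => by
      rw [← Matrix.mul_assoc, hb₂, Matrix.one_mul]
    apply fromBlocks_mem
    · simp only [transpose_smul, transpose_sub, transpose_mul, transpose_transpose, ha.eq, hc.eq,
        Matrix.smul_mul, Matrix.mul_smul, Matrix.mul_sub, Matrix.sub_mul, Matrix.mul_assoc, hb₁,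
        Matrix.mul_one, e]
      module
    · simp only [transpose_smul, transpose_mul, transpose_transpose, ha.eq,
        Matrix.smul_mul, Matrix.mul_smul, Matrix.mul_assoc]
    · simp only [transpose_smul, transpose_sub, transpose_mul, transpose_transpose, ha.eq, hc.eq,
        Matrix.smul_mul, Matrix.mul_smul, Matrix.sub_mul, Matrix.mul_assoc, hb₂]
      module⟩

/-- The group generated by the elements `(g^{(r)})⁻¹ g^{(s)}`, where `r, s` range over the units
of `R` and `g^{(r)}` denotes the dilate of `g` by `r`. -/
def dilateGroup (g : Sp R) : Subgroup (Sp R) :=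
  Subgroup.closure {x | ∃ r s : Rˣ, x = (dilation r g)⁻¹ * dilation s g}

end Elements

/-- An integral quadratic form `Q(x, y) = xᵀ a x + xᵀ b y + yᵀ c y` on `ℤ⁸ = ℤ⁴ × ℤ⁴`, given by its
coefficient matrices, with `a` and `c` symmetric. -/
structure QuadForm where
  a : Matrix (Fin 4) (Fin 4) ℤ
  b : Matrix (Fin 4) (Fin 4) ℤ
  c : Matrix (Fin 4) (Fin 4) ℤ
  a_symm : a.IsSymm
  c_symm : c.IsSymm

namespace QuadForm

variable (Q : QuadForm)

/-- The matrix discriminant `Δ = 4 b⁻¹ a b⁻ᵀ c - I`, over `ℚ` (meaningful when `det b ≠ 0`). -/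
def discr : Matrix (Fin 4) (Fin 4) ℚ :=
  let a := Q.a.map (Int.cast : ℤ → ℚ)
  let b := Q.b.map (Int.cast : ℤ → ℚ)
  let c := Q.c.map (Int.cast : ℤ → ℚ)
  (4 : ℚ) • (b⁻¹ * a * b⁻¹ᵀ * c) - 1

/-- The set of eigenvalues of `Δ` in an algebraic closure of `ℚ`. -/
def discrEigenvalues : Set (AlgebraicClosure ℚ) :=
  {μ | Module.End.HasEigenvalue
    (Matrix.toLin' (Q.discr.map (algebraMap ℚ (AlgebraicClosure ℚ)))) μ}

/-- `Q` is generic: `det (ab) ≠ 0`, and `Δ` has four distinct eigenvalues in the algebraic closure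
of `ℚ`, none of which is `0` or `-1`. -/
def IsGeneric : Prop :=
  (Q.a * Q.b).det ≠ 0 ∧ Q.discrEigenvalues.ncard = 4 ∧
    0 ∉ Q.discrEigenvalues ∧ -1 ∉ Q.discrEigenvalues

/-- The symplectic element of `Q`, regarded as an element of `Sp₈(ℤ/p)` when `p ∤ det b`. -/
def symplecticMod (p : ℕ) (hb : IsUnit (Q.b.map (Int.cast : ℤ → ZMod p)).det) : Sp (ZMod p) :=
  symplecticElement (Q.a.map (Int.cast : ℤ → ZMod p)) (Q.b.map (Int.cast : ℤ → ZMod p))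
    (Q.c.map (Int.cast : ℤ → ZMod p)) (Q.a_symm.map _) (Q.c_symm.map _) hb

/-- The group `Γ_p ≤ Sp₈(ℤ/p)` attached to `Q`, for `p ∤ det b`. -/
def Gamma (p : ℕ) (hb : IsUnit (Q.b.map (Int.cast : ℤ → ZMod p)).det) : Subgroup (Sp (ZMod p)) :=
  dilateGroup (Q.symplecticMod p hb)

end QuadForm

/-- `ℓ²((ℤ/p)⁴)`, the complex functions on `(ℤ/p)⁴`. (Normalising the inner product by an average
instead of a sum gives the same unitary operators.) -/
abbrev L2 (p : ℕ) [Fact p.Prime] := EuclideanSpace ℂ (Fin 4 → ZMod p)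

/-- A unitary representation of `Sp₈(ℤ/p)` on `ℓ²((ℤ/p)⁴)`. The group of linear isometric
automorphisms of a Hermitian space is its unitary group. -/
abbrev UnitaryRep (p : ℕ) [Fact p.Prime] := Sp (ZMod p) →* (L2 p ≃ₗᵢ[ℂ] L2 p)

/-- `ρ` is the mod `p` Weil representation: for some phase function `ξ`, the elements `s(E)`, `J`
and `l(W)` act, up to the phase, as dilation, Fourier transform and quadratic modulation.
Here `ZMod.stdAddChar` is `e_p(t) = exp(2πit/p)`. -/
def IsWeilRep (p : ℕ) [Fact p.Prime] (ρ : UnitaryRep p) : Prop :=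
  ∃ ξ : Sp (ZMod p) → Circle,
    (∀ (E : GL (Fin 4) (ZMod p)) (f : L2 p) (x : Fin 4 → ZMod p),
      ρ (s E) f x =
        (ξ (s E) : ℂ) * f (((E⁻¹ : GL (Fin 4) (ZMod p)) : Matrix (Fin 4) (Fin 4) (ZMod p)) *ᵥ x)) ∧
    (∀ (f : L2 p) (x : Fin 4 → ZMod p),
      ρ J f x = (ξ J : ℂ) * ((p : ℂ) ^ 2 *
        ((∑ y : Fin 4 → ZMod p, f y * ZMod.stdAddChar (x ⬝ᵥ y)) / (p : ℂ) ^ 4))) ∧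
    (∀ (W : Matrix (Fin 4) (Fin 4) (ZMod p)) (hW : W.IsSymm) (f : L2 p) (x : Fin 4 → ZMod p),
      ρ (l W hW) f x =
        (ξ (l W hW) : ℂ) * (ZMod.stdAddChar (-(2 : ZMod p)⁻¹ * (x ⬝ᵥ W *ᵥ x)) * f x))

/-- The twist `x ↦ ρ(x^{(r)})` of `ρ` by dilation by `r`. -/
def UnitaryRep.twist {p : ℕ} [Fact p.Prime] (ρ : UnitaryRep p) (r : (ZMod p)ˣ) : UnitaryRep p :=
  ρ.comp (dilation r)

end Sp8

end

/-! After conjugation by diag(1, S), with S = 2b⁻¹ab⁻ᵀ, every quotient of dilates (g^{(s)})⁻¹g^{(t)}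
becomes a 2 × 2 matrix of determinant one over the four-dimensional commutative algebra R =
𝔽_p[X]/(χ), where χ is the characteristic polynomial of Δ (`dilation_mul_blockTransfer`). Let H ≤
SL₂(R) be the group generated by these matrices. The main point is that H contains every lower
unipotent (`lowerSL_mem_dilateSubgroup`).

This uses the polynomial method. Evaluation at the four eigenvalues sends H to a set G in SL₂(F)⁴, F
algebraically closed. For fixed s, a form of degree much smaller than p that vanishes on G vanishes
at p - 1 points of a curve of degree 2, hence on the whole curve, so its derivative along the curve
vanishes on G too. The resulting directions generate all of sl₂⁴ as a Lie algebra, because the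
eigenvalues are distinct and avoid 0 and -1 (`tangent_eq_sl2`). Such a form therefore vanishes on a
dense part of SL₂(F)⁴. By linear algebra, a set with no equations of degree below a multiple of p
has at least a constant times p¹² elements (`card_le_of_dilateStable`). There are at most p⁸ second
columns over R, so H has more than p³ lower unipotents; their parameters form an 𝔽_p-subspace of R,
which must be everything.

Consequently Γ_p contains l(S⁻¹q(Δ)) for all polynomials q. These act by quadratic modulations, so
an invariant f is supported where yᵀS⁻¹Δᵏy = 0 for all k, and diagonalising Δ gives y = 0. Thus f is
a multiple of the delta function at 0. A dilate g^{(t)} maps that to a constant times the chirp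
e_p(t xᵀax), which invariance requires to be independent of t; as a ≠ 0, f = 0
(`eq_zero_of_twist_invariant`).

Existence of a Weil representation comes from intertwiners of the Weyl operators, unique up to a
phase. The phase is fixed by requiring equal determinants on even and on odd functions; the two
dimensions differ by one, so this leaves no freedom, and the choice is multiplicative
(`exists_weilHom`). -/

noncomputable section

namespace Sp8

/-! ### Invariant derivations on polynomials in matrix entries. -/

open MvPolynomial in
theorem mkDerivation_eq_sum_pderiv {σ F : Type*} [Fintype σ] [CommRing F]
    (f : σ → MvPolynomial σ F) (P : MvPolynomial σ F) :
    mkDerivation F f P = ∑ i, pderiv i P * f i := by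
  classical
  have : mkDerivation F f = ∑ i, f i • (pderiv i : Derivation F (MvPolynomial σ F) _) := by
    apply MvPolynomial.derivation_ext
    intro j
    rw [mkDerivation_X]
    have : ∀ (s : Finset σ), (∑ i ∈ s, f i • (pderiv i : Derivation F (MvPolynomial σ F) _)) (X j)
      = ∑ i ∈ s, f i * pderiv i (X j) := by
      intro s
      induction s using Finset.induction_on with
      | empty => simp
      | insert a s ha ih => rw [Finset.sum_insert ha, Finset.sum_insert ha, Derivation.add_apply, ih]; simp
    rw [this]
    simp [pderiv_X, Pi.single_apply]
  rw [this]
  have : ∀ (s : Finset σ), (∑ i ∈ s, f i • (pderiv i : Derivation F (MvPolynomial σ F) _)) P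
      = ∑ i ∈ s, f i * pderiv i P := by
      intro s
      induction s using Finset.induction_on with
      | empty => simp
      | insert a s ha ih => rw [Finset.sum_insert ha, Finset.sum_insert ha, Derivation.add_apply, ih]; simp
  rw [this]
  simp [mul_comm]

open MvPolynomial in
theorem derivative_aeval {σ F : Type*} [Fintype σ] [CommRing F]
    (N : σ → Polynomial F) (P : MvPolynomial σ F) :
    Polynomial.derivative (aeval N P) = ∑ i, aeval N (pderiv i P) * Polynomial.derivative (N i) := by
  classical
  induction P using MvPolynomial.induction_on with
  | C a => simp
  | add p q hp hq => simp [hp, hq, add_mul, Finset.sum_add_distrib]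
  | mul_X p j hp =>
    have h : ∀ i, aeval N (pderiv i (p * X j)) * Polynomial.derivative (N i) =
        N j * (aeval N (pderiv i p) * Polynomial.derivative (N i)) +
        if j = i then aeval N p * Polynomial.derivative (N i) else 0 := by
      intro i
      rw [Derivation.leibniz, pderiv_X, Pi.single_apply]
      split_ifs <;> simp <;> ring
    rw [Finset.sum_congr rfl fun i _ => h i, Finset.sum_add_distrib, ← Finset.mul_sum, ← hp,
      Finset.sum_ite_eq]
    simp [Polynomial.derivative_mul]
    ring

open MvPolynomial in
theorem eval_aeval_polynomial {σ F : Type*} [CommRing F]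
    (N : σ → Polynomial F) (P : MvPolynomial σ F) (x : F) :
    (aeval N P).eval x = eval (fun i => (N i).eval x) P := by
  induction P using MvPolynomial.induction_on with
  | C a => simp
  | add p q hp hq => simp [hp, hq]
  | mul_X p j hp => simp [hp]

open MvPolynomial in
theorem eval_smul_of_isHomogeneous {σ F : Type*} [CommRing F] {P : MvPolynomial σ F} {d : ℕ}
    (hP : P.IsHomogeneous d) (c : F) (x : σ → F) : eval (c • x) P = c ^ d * eval x P := by
  rw [eval_eq, eval_eq, Finset.mul_sum]
  refine Finset.sum_congr rfl fun m hm => ?_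
  have := hP (mem_support_iff.1 hm)
  simp only [Pi.smul_apply, smul_eq_mul, mul_pow, Finset.prod_mul_distrib]
  rw [Finset.prod_pow_eq_pow_sum, ← this]
  simp only [Finsupp.weight_apply, Finsupp.sum, Pi.one_apply, smul_eq_mul, mul_one]
  ring

open MvPolynomial in
theorem isHomogeneous_mkDerivation {σ F : Type*} [Fintype σ] [CommRing F] {f : σ → MvPolynomial σ F}
    (hf : ∀ i, (f i).IsHomogeneous 1) {P : MvPolynomial σ F} {d : ℕ} (hd : d ≠ 0)
    (hP : P.IsHomogeneous d) : (mkDerivation F f P).IsHomogeneous d := by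
  rw [mkDerivation_eq_sum_pderiv]
  refine IsHomogeneous.sum _ _ _ fun i _ => ?_
  obtain ⟨e, rfl⟩ := Nat.exists_eq_succ_of_ne_zero hd
  exact (hP.pderiv).mul (hf i)

variable {ι F : Type*} [Field F]

/-- The point of affine space given by the entries of a tuple of `2 × 2` matrices. -/
def entries {S : Type*} (g : ι → Matrix (Fin 2) (Fin 2) S) : ι × Fin 2 × Fin 2 → S :=
  fun k => g k.1 k.2.1 k.2.2

open MvPolynomial in
/-- The left invariant derivation `Z ↦ Z Y` on polynomials in the entries of a tuple `Z` of
`2 × 2` matrices. -/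
def invDer (Y : ι → Matrix (Fin 2) (Fin 2) F) :
    Derivation F (MvPolynomial (ι × Fin 2 × Fin 2) F) (MvPolynomial (ι × Fin 2 × Fin 2) F) :=
  mkDerivation F fun k => ∑ c, X (k.1, k.2.1, c) * C (Y k.1 c k.2.2)

open MvPolynomial in
theorem invDer_X (Y : ι → Matrix (Fin 2) (Fin 2) F) (k : ι × Fin 2 × Fin 2) :
    invDer Y (X k) = ∑ c, X (k.1, k.2.1, c) * C (Y k.1 c k.2.2) := mkDerivation_X _ _ _

theorem invDer_add (Y Z : ι → Matrix (Fin 2) (Fin 2) F) : invDer (Y + Z) = invDer Y + invDer Z := by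
  apply MvPolynomial.derivation_ext
  intro k
  simp only [Derivation.add_apply, invDer_X]
  rw [← Finset.sum_add_distrib]
  simp [mul_add]

theorem invDer_smul (r : F) (Y : ι → Matrix (Fin 2) (Fin 2) F) : invDer (r • Y) = r • invDer Y := by
  apply MvPolynomial.derivation_ext
  intro k
  simp only [Derivation.smul_apply, invDer_X, Finset.smul_sum]
  refine Finset.sum_congr rfl fun c _ => ?_
  simp [MvPolynomial.smul_eq_C_mul]
  ring

/-- Both sides are derivations, so generators suffice. This is what makes `tangent` a Lie algebra.
-/
theorem invDer_commutator (Y Z : ι → Matrix (Fin 2) (Fin 2) F) :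
    invDer (Y * Z - Z * Y) = ⁅invDer Y, invDer Z⁆ := by
  apply MvPolynomial.derivation_ext
  intro k
  simp only [Derivation.commutator_apply, invDer_X, map_sum, Derivation.leibniz, 
    MvPolynomial.derivation_C, smul_zero, zero_add]
  simp [Fin.sum_univ_two, Matrix.mul_apply]
  ring

open MvPolynomial in
theorem isHomogeneous_invDer [Fintype ι] (Y : ι → Matrix (Fin 2) (Fin 2) F)
    {P : MvPolynomial (ι × Fin 2 × Fin 2) F} {d : ℕ} (hd : d ≠ 0) (hP : P.IsHomogeneous d) :
    (invDer Y P).IsHomogeneous d :=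
  isHomogeneous_mkDerivation (fun k => IsHomogeneous.sum _ _ _ fun c _ => by
    simpa using (isHomogeneous_X F (k.1, k.2.1, c)).mul (isHomogeneous_C _ (Y k.1 c k.2.2))) hd hP

-- Chain rule along a polynomial path through g with velocity gY. The factor r serves paths that
-- pass through a scalar multiple of a group element.
open MvPolynomial in
theorem eval_derivative_aeval_entries [Fintype ι] (Y g : ι → Matrix (Fin 2) (Fin 2) F)
    (N : ι → Matrix (Fin 2) (Fin 2) (Polynomial F)) (x r : F)
    (hN : ∀ k, (entries N k).eval x = entries g k)
    (hN' : ∀ k, r * (Polynomial.derivative (entries N k)).eval x = entries (g * Y) k)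
    (P : MvPolynomial (ι × Fin 2 × Fin 2) F) :
    r * (Polynomial.derivative (aeval (entries N) P)).eval x = eval (entries g) (invDer Y P) := by
  rw [derivative_aeval, invDer, mkDerivation_eq_sum_pderiv, map_sum, Polynomial.eval_finsetSum,
    Finset.mul_sum]
  refine Finset.sum_congr rfl fun k _ => ?_
  rw [Polynomial.eval_mul, eval_aeval_polynomial, map_mul, mul_left_comm, hN']
  congr 1
  · congr 2; ext k; rw [hN]
  · simp [entries, Matrix.mul_apply]

/-- In suitable coordinates, the quotient of two dilates of a symplectic element with
discriminant `x`. -/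
def dilateMatrix {R : Type*} [CommRing R] (s t : Rˣ) (x : R) : Matrix (Fin 2) (Fin 2) R :=
  !![1 + (1 - t * (s⁻¹ : Rˣ)) * x, (s⁻¹ : Rˣ) - (t⁻¹ : Rˣ);
    (s - t) * (x * (x + 1)), 1 + (1 - s * (t⁻¹ : Rˣ)) * x]

theorem dilateMatrix_map {R S : Type*} [CommRing R] [CommRing S] (f : R →+* S) (s t : Rˣ) (x : R) :
    (dilateMatrix s t x).map f = dilateMatrix (Units.map f s) (Units.map f t) (f x) := by
  ext i j
  fin_cases i <;> fin_cases j <;> simp [dilateMatrix, ← map_inv]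

theorem det_dilateMatrix {R : Type*} [CommRing R] (s t : Rˣ) (x : R) :
    (dilateMatrix s t x).det = 1 := by
  have hs := s.mul_inv
  have ht := t.mul_inv
  rw [dilateMatrix, det_fin_two_of]
  linear_combination (x ^ 2 * (t * (t⁻¹ : Rˣ)) - x - x ^ 2) * hs - x * ht

variable {ι F : Type*} [Field F]

/-! ### Forms vanishing on a set and the Lie algebra preserving them. -/

section Vanishing

open MvPolynomial

/-- Homogeneous polynomials of degree `d` vanishing on `G`. -/
def vanishing (G : Set (ι → Matrix (Fin 2) (Fin 2) F)) (d : ℕ) :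
    Submodule F (MvPolynomial (ι × Fin 2 × Fin 2) F) where
  carrier := {P | P.IsHomogeneous d ∧ ∀ g ∈ G, eval (entries g) P = 0}
  add_mem' := fun h h' => ⟨h.1.add h'.1, fun g hg => by rw [map_add, h.2 g hg, h'.2 g hg, add_zero]⟩
  zero_mem' := ⟨isHomogeneous_zero _ _ _, fun g _ => map_zero _⟩
  smul_mem' := fun r P h => ⟨(homogeneousSubmodule _ _ d).smul_mem r h.1, fun g hg => by
    rw [smul_eval, h.2 g hg, mul_zero]⟩

/-- The Lie algebra of tuples of matrices preserving the polynomials vanishing on `G`. -/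
def tangent (G : Set (ι → Matrix (Fin 2) (Fin 2) F)) (d : ℕ) :
    Submodule F (ι → Matrix (Fin 2) (Fin 2) F) where
  carrier := {Y | ∀ P ∈ vanishing G d, invDer Y P ∈ vanishing G d}
  add_mem' := fun h h' P hP => by
    rw [invDer_add, Derivation.add_apply]
    exact add_mem (h P hP) (h' P hP)
  zero_mem' := fun P hP => by
    have : invDer (0 : ι → Matrix (Fin 2) (Fin 2) F) = 0 := by
      simpa using invDer_smul (0 : F) (0 : ι → Matrix (Fin 2) (Fin 2) F)
    rw [this]
    exact zero_mem _
  smul_mem' := fun r Y h P hP => by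
    rw [invDer_smul, Derivation.smul_apply]
    exact Submodule.smul_mem _ _ (h P hP)

theorem commutator_mem_tangent {G : Set (ι → Matrix (Fin 2) (Fin 2) F)} {d : ℕ}
    {Y Z : ι → Matrix (Fin 2) (Fin 2) F} (hY : Y ∈ tangent G d) (hZ : Z ∈ tangent G d) :
    Y * Z - Z * Y ∈ tangent G d := fun P hP => by
  rw [invDer_commutator, Derivation.commutator_apply]
  exact sub_mem (hY _ (hZ P hP)) (hZ _ (hY P hP))

/-- Right translation of polynomials. -/
def rightTranslate (h : ι → Matrix (Fin 2) (Fin 2) F) :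
    MvPolynomial (ι × Fin 2 × Fin 2) F →ₐ[F] MvPolynomial (ι × Fin 2 × Fin 2) F :=
  aeval fun k => ∑ c, X (k.1, k.2.1, c) * C (h k.1 c k.2.2)

theorem eval_rightTranslate (g h : ι → Matrix (Fin 2) (Fin 2) F)
    (P : MvPolynomial (ι × Fin 2 × Fin 2) F) :
    eval (entries g) (rightTranslate h P) = eval (entries (g * h)) P := by
  induction P using MvPolynomial.induction_on with
  | C a => simp [rightTranslate]
  | add p q hp hq => simp only [map_add, hp, hq]
  | mul_X p j hp =>
    simp only [map_mul, hp]
    congr 1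
    simp [rightTranslate, entries, Matrix.mul_apply]

theorem rightTranslate_mem_vanishing {G : Set (ι → Matrix (Fin 2) (Fin 2) F)} {d : ℕ}
    {h : ι → Matrix (Fin 2) (Fin 2) F} {P : MvPolynomial (ι × Fin 2 × Fin 2) F}
    (hP : P ∈ vanishing G d) (H : ∀ g ∈ G, eval (entries (g * h)) P = 0) :
    rightTranslate h P ∈ vanishing G d := by
  refine ⟨?_, fun g hg => by rw [eval_rightTranslate, H g hg]⟩
  have hX : ∀ k : ι × Fin 2 × Fin 2,
      (∑ c, X (k.1, k.2.1, c) * C (h k.1 c k.2.2) :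
        MvPolynomial (ι × Fin 2 × Fin 2) F).IsHomogeneous 1 := fun k =>
    IsHomogeneous.sum _ _ _ fun c _ => by
      simpa using (isHomogeneous_X F (k.1, k.2.1, c)).mul (isHomogeneous_C _ (h k.1 c k.2.2))
  have := IsHomogeneous.aeval hP.1 _ hX
  rw [one_mul] at this
  exact this

/-- Exponentiation of a square-zero tangent direction in characteristic p. All derivatives at x = 0
of x ↦ P(g(1 + xY)) are values at g of forms vanishing on G. The degree is below p, so the Taylor
coefficients vanish, and x = 1 gives the claim. -/
theorem rightTranslate_unipotent_mem [Fintype ι] [Infinite F] {p : ℕ} [hp : Fact p.Prime] [CharP F p]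
    {G : Set (ι → Matrix (Fin 2) (Fin 2) F)} {d : ℕ} (hd : d < p)
    {Y : ι → Matrix (Fin 2) (Fin 2) F} (hY : Y ∈ tangent G d) (hYY : Y * Y = 0)
    {P : MvPolynomial (ι × Fin 2 × Fin 2) F} (hP : P ∈ vanishing G d) :
    rightTranslate (1 + Y) P ∈ vanishing G d := by
  refine rightTranslate_mem_vanishing hP fun g hg => ?_
  let N : ι → Matrix (Fin 2) (Fin 2) (Polynomial F) := fun i =>
    of fun a b => Polynomial.C (g i a b) + Polynomial.C ((g * Y) i a b) * Polynomial.X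
  have hN : ∀ x k, (entries N k).eval x = entries (g * (1 + x • Y)) k := fun x k => by
    simp only [N, entries, of_apply, mul_add, mul_one, mul_smul_comm, Pi.add_apply, Pi.smul_apply,
      Matrix.add_apply, Matrix.smul_apply, smul_eq_mul, Polynomial.eval_add, Polynomial.eval_mul,
      Polynomial.eval_C, Polynomial.eval_X]
    ring
  -- Since Y² = 0, the velocity gY of the path equals g(1 + xY)Y at every x, so differentiation
  -- along it is `invDer Y`.
  have hder : ∀ Q : MvPolynomial (ι × Fin 2 × Fin 2) F,
      Polynomial.derivative (aeval (entries N) Q) = aeval (entries N) (invDer Y Q) := fun Q => by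
    refine Polynomial.funext fun x => ?_
    have := eval_derivative_aeval_entries Y (g * (1 + x • Y)) N x 1 (hN x) (fun k => by
      rw [mul_assoc, add_mul, smul_mul_assoc, hYY]
      simp [N, entries]) Q
    rw [one_mul] at this
    rw [this, eval_aeval_polynomial]
    congr 2
    ext k
    rw [hN]
  have hit : ∀ j, ∃ Q ∈ vanishing G d,
      Polynomial.derivative^[j] (aeval (entries N) P) = aeval (entries N) Q := fun j => by
    induction j with
    | zero => exact ⟨P, hP, rfl⟩
    | succ j ih =>
      obtain ⟨Q, hQ, e⟩ := ih
      exact ⟨_, hY Q hQ, by rw [Function.iterate_succ_apply', e, hder]⟩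
  have hev : ∀ (Q : MvPolynomial (ι × Fin 2 × Fin 2) F) x, (aeval (entries N) Q).eval x =
      eval (entries (g * (1 + x • Y))) Q := fun Q x => by
    rw [eval_aeval_polynomial]
    congr 2
    ext k
    rw [hN]
  have hdeg : (aeval (entries N) P).natDegree ≤ d := by
    have := aeval_natDegree_le P hP.1.totalDegree_le (entries N) (n := 1) fun k => by
      simp only [N, entries, of_apply]
      rw [add_comm]
      exact Polynomial.natDegree_linear_le
    simpa using this
  have hzero : aeval (entries N) P = 0 := by
    ext j
    rw [Polynomial.coeff_zero]
    rcases lt_or_ge d j with h | h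
    · exact Polynomial.coeff_eq_zero_of_natDegree_lt (hdeg.trans_lt h)
    · obtain ⟨Q, hQ, e⟩ := hit j
      have h0 := hev Q 0
      rw [zero_smul, add_zero, mul_one, hQ.2 g hg, ← e, ← Polynomial.coeff_zero_eq_eval_zero,
        Polynomial.coeff_iterate_derivative, zero_add, Nat.descFactorial_self, nsmul_eq_mul] at h0
      refine (mul_eq_zero.1 h0).resolve_left fun h1 => ?_
      -- The j-th derivative at 0 is j! times the j-th coefficient, and j ≤ d < p makes j!
      -- invertible.
      rw [CharP.cast_eq_zero_iff F p, hp.out.dvd_factorial] at h1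
      omega
  have := hev P 1
  rwa [hzero, Polynomial.eval_zero, one_smul, eq_comm] at this

end Vanishing

/-! ### The tangent algebra of a set stable under dilate quotients. -/

section

variable {ι F : Type*} [Field F]

/-- The derivative of `t ↦ t • dilateMatrix s t x` at `t = s`. -/
def dilateTangent (s x : F) : Matrix (Fin 2) (Fin 2) F :=
  !![1 - x, s⁻¹; -(s * (x * (x + 1))), 1 + x]

open Polynomial in
/-- The polynomial path `t ↦ t • dilateMatrix s t x`. -/
def dilatePath (s x : F) : Matrix (Fin 2) (Fin 2) F[X] :=
  !![X + C x * (X - C s⁻¹ * X ^ 2), C s⁻¹ * X - 1;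
    C (x * (x + 1)) * (C s * X - X ^ 2), X + (X - C s) * C x]

theorem dilatePath_eval_unit (s t : Fˣ) (x : F) (i j : Fin 2) :
    (dilatePath (s : F) x i j).eval (t : F) = t * dilateMatrix s t x i j := by
  have := t.mul_inv
  fin_cases i <;> fin_cases j <;> simp [dilatePath, dilateMatrix] <;> field_simp

theorem dilatePath_eval_self {s : F} (hs : s ≠ 0) (x : F) (i j : Fin 2) :
    (dilatePath s x i j).eval s = s * (1 : Matrix (Fin 2) (Fin 2) F) i j := by
  fin_cases i <;> fin_cases j <;> simp [dilatePath] <;> field_simp <;> simp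

theorem dilatePath_derivative {s : F} (hs : s ≠ 0) (x : F) (i j : Fin 2) :
    (Polynomial.derivative (dilatePath s x i j)).eval s = dilateTangent s x i j := by
  fin_cases i <;> fin_cases j <;> simp [dilatePath, dilateTangent] <;> field_simp <;> ring

theorem dilatePath_natDegree (s x : F) (i j : Fin 2) : (dilatePath s x i j).natDegree ≤ 2 := by
  fin_cases i <;> fin_cases j <;> simp [dilatePath] <;> compute_degree
  all_goals norm_num

section

variable {p : ℕ} [hp : Fact p.Prime] [Algebra (ZMod p) F]

/-- The image in `Fˣ` of a unit of `ℤ/p`. -/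
abbrev unitMap (p : ℕ) (R : Type*) [CommRing R] [Algebra (ZMod p) R] : (ZMod p)ˣ →* Rˣ :=
  Units.map (algebraMap (ZMod p) R)

/-- `G` is stable under right multiplication by the tuples `dilateMatrix s t (x i)` for units
`s, t` of `ℤ/p`. -/
def DilateStable (p : ℕ) [Fact p.Prime] [Algebra (ZMod p) F] (x : ι → F)
    (G : Set (ι → Matrix (Fin 2) (Fin 2) F)) : Prop :=
  ∀ g ∈ G, ∀ s t : (ZMod p)ˣ,
    (g * fun i => dilateMatrix (unitMap p F s) (unitMap p F t) (x i)) ∈ G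

variable {x : ι → F} {G : Set (ι → Matrix (Fin 2) (Fin 2) F)} {d : ℕ}

-- For fixed s, multiplying by t turns t ↦ g · `dilateMatrix s t x` into a path of degree 2 in t.
-- Homogeneity of P makes the factor t harmless, so P along the path has degree at most 2d and p - 1
-- roots, hence is zero. Its derivative at t = s is the value to be killed.
open MvPolynomial in
theorem dilateTangent_mem [Fintype ι] (hG : DilateStable p x G) (hd : d ≠ 0) (hdp : d * 2 < p - 1)
    (s : (ZMod p)ˣ) : (fun i => dilateTangent (unitMap p F s : F) (x i)) ∈ tangent G d := by
  intro P hP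
  refine ⟨isHomogeneous_invDer _ hd hP.1, fun g hg => ?_⟩
  set u : Fˣ := unitMap p F s with hu
  let N : ι → Matrix (Fin 2) (Fin 2) (Polynomial F) := fun i =>
    of fun a b => ∑ c, Polynomial.C (g i a c) * dilatePath (u : F) (x i) c b
  have hdeg : (aeval (entries N) P).natDegree ≤ d * 2 := by
    refine aeval_natDegree_le P hP.1.totalDegree_le (entries N) fun k => ?_
    simp only [N, entries, of_apply]
    refine Polynomial.natDegree_sum_le_of_forall_le _ _ fun c _ => ?_
    exact (Polynomial.natDegree_C_mul_le _ _).trans (dilatePath_natDegree _ _ _ _)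
  have hzero : aeval (entries N) P = 0 := by
    refine Polynomial.eq_zero_of_natDegree_lt_card_of_eval_eq_zero _
      (f := fun t : (ZMod p)ˣ => (unitMap p F t : F)) ?_ (fun t => ?_) ?_
    · intro t t' h
      exact Units.ext ((algebraMap (ZMod p) F).injective h)
    · rw [eval_aeval_polynomial]
      have e : (fun k => (entries N k).eval (unitMap p F t : F)) = (unitMap p F t : F) •
          entries (g * fun i => dilateMatrix u (unitMap p F t) (x i)) := by
        ext k
        simp only [entries, N, of_apply, Polynomial.eval_finsetSum, Polynomial.eval_mul,
          Polynomial.eval_C, dilatePath_eval_unit, Pi.smul_apply, Pi.mul_apply, Matrix.mul_apply,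
          smul_eq_mul, Finset.mul_sum]
        exact Finset.sum_congr rfl fun c _ => by ring
      rw [e, eval_smul_of_isHomogeneous hP.1, hP.2 _ (hG g hg s t), mul_zero]
    · rw [ZMod.card_units]
      omega
  -- At t = u the path is at u • g with velocity g · `dilateTangent`; multiplying the velocity by u
  -- gives the form required by the chain rule.
  have key := eval_derivative_aeval_entries (fun i => dilateTangent (u : F) (x i)) ((u : F) • g) N
    (u : F) (u : F) (fun k => ?_) (fun k => ?_) P
  · rw [hzero, Polynomial.derivative_zero, Polynomial.eval_zero, mul_zero] at key
    have e : entries ((u : F) • g) = (u : F) • entries g := rfl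
    rw [e, eval_smul_of_isHomogeneous (isHomogeneous_invDer _ hd hP.1)] at key
    exact (mul_eq_zero.1 key.symm).resolve_left (pow_ne_zero _ u.ne_zero)
  · simp only [entries, N, of_apply, Polynomial.eval_finsetSum, Polynomial.eval_mul,
      Polynomial.eval_C, dilatePath_eval_self u.ne_zero, Pi.smul_apply, Matrix.smul_apply, smul_eq_mul]
    rw [← mul_one (g k.1), Matrix.mul_apply, Finset.mul_sum, mul_one]
    exact Finset.sum_congr rfl fun c _ => by ring
  · simp only [entries, N, of_apply, Polynomial.derivative_sum, Polynomial.eval_finsetSum,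
      Polynomial.derivative_C_mul, Polynomial.eval_mul, Polynomial.eval_C,
      dilatePath_derivative u.ne_zero, Pi.smul_apply, Matrix.smul_apply, smul_eq_mul,
      Pi.mul_apply, Matrix.mul_apply, Finset.mul_sum, mul_assoc]

/-- Tuples of strictly upper triangular matrices. -/
def upperTuple (c : ι → F) : ι → Matrix (Fin 2) (Fin 2) F := fun i => !![0, c i; 0, 0]

/-- Tuples of strictly lower triangular matrices. -/
def lowerTuple (c : ι → F) : ι → Matrix (Fin 2) (Fin 2) F := fun i => !![0, 0; c i, 0]

/-- W contains q(x)y for every polynomial q; the x i are distinct, so Lagrange interpolation reaches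
every tuple. -/
theorem mem_submodule_of_mul_mem [Fintype ι] [DecidableEq ι] (W : Submodule F (ι → F))
    (hx : Function.Injective x) {y : ι → F} (hy : ∀ i, y i ≠ 0) (hyW : y ∈ W)
    (hW : ∀ c ∈ W, x * c ∈ W) (c : ι → F) : c ∈ W := by
  have h1 : ∀ q : Polynomial F, (fun i => q.eval (x i) * y i) ∈ W := fun q => by
    induction q using Polynomial.induction_on' with
    | add q r hq hr =>
      simp only [Polynomial.eval_add, add_mul]
      exact add_mem hq hr
    | monomial n a =>
      simp only [Polynomial.eval_monomial, mul_assoc]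
      refine W.smul_mem a (x := fun i => x i ^ n * y i) ?_
      induction n with
      | zero => simpa using hyW
      | succ n ih =>
        convert hW _ ih using 1
        ext i
        simp only [Pi.mul_apply]
        ring
  have h2 := h1 (Lagrange.interpolate Finset.univ x fun i => c i / y i)
  convert h2 using 1
  ext i
  rw [Lagrange.eval_interpolate_at_node _ hx.injOn (Finset.mem_univ i), div_mul_cancel₀ _ (hy i)]

variable [Fintype ι]

/-- The tangent at s is H + s⁻¹U - sL with H = diag(1 - x, 1 + x), U upper with entry 1 and L lower
with entry x(x + 1). The values s = ±1, ±2 separate the three parts. Bracketing with H multiplies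
upper entries by -2x and lower ones by 2x, and interpolation in the distinct x i does the rest. L
has no zero entry because x avoids 0 and -1. -/
theorem tangent_eq_sl2 [DecidableEq ι] (hG : DilateStable p x G) (hd : d ≠ 0)
    (hdp : d * 2 < p - 1) (hp3 : 3 < p) (hx : Function.Injective x) (hx0 : ∀ i, x i ≠ 0)
    (hx1 : ∀ i, x i ≠ -1) (c : ι → F) :
    upperTuple c ∈ tangent G d ∧ lowerTuple c ∈ tangent G d := by
  have : CharP F p := charP_of_injective_algebraMap (algebraMap (ZMod p) F).injective p
  have h2 : (2 : F) ≠ 0 := by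
    intro h
    have := (CharP.cast_eq_zero_iff F p 2).1 (by exact_mod_cast h)
    have := Nat.le_of_dvd (by norm_num) this
    omega
  have h3 : (3 : F) ≠ 0 := by
    intro h
    have := (CharP.cast_eq_zero_iff F p 3).1 (by exact_mod_cast h)
    have := Nat.le_of_dvd (by norm_num) this
    omega
  have h2' : (2 : ZMod p) ≠ 0 := by
    intro h
    have := (ZMod.natCast_eq_zero_iff 2 p).1 (by exact_mod_cast h)
    have := Nat.le_of_dvd (by norm_num) this
    omega
  have T := fun s => dilateTangent_mem hG hd hdp s
  have T1 := T 1
  have T1' := T (-1)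
  have T2 := T (Units.mk0 2 h2')
  have T2' := T (-Units.mk0 2 h2')
  simp only [map_one, Units.coe_map, Units.val_neg, Units.val_one, Units.val_mk0, MonoidHom.coe_coe,
    map_neg, map_ofNat] at T1 T1' T2 T2'
  have hH : (fun i => !![1 - x i, 0; 0, 1 + x i]) ∈ tangent G d := by
    convert Submodule.smul_mem _ (2 : F)⁻¹ (add_mem T1 T1') using 1
    ext i a b
    fin_cases a <;> fin_cases b <;> simp [dilateTangent] <;> field_simp <;> ring
  have hU : upperTuple (1 : ι → F) ∈ tangent G d := by
    convert Submodule.smul_mem _ (2 * 3⁻¹ : F)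
      (sub_mem (sub_mem T1 T1') (Submodule.smul_mem _ (2 : F)⁻¹ (sub_mem T2 T2'))) using 1
    ext i a b
    fin_cases a <;> fin_cases b <;> simp [dilateTangent, upperTuple] <;> field_simp <;> try simp
    all_goals ring
  have hL : lowerTuple (fun i => x i * (x i + 1)) ∈ tangent G d := by
    convert Submodule.smul_mem _ (2⁻¹ * 3⁻¹ : F)
      (sub_mem (sub_mem T1 T1') (Submodule.smul_mem _ (2 : F) (sub_mem T2 T2'))) using 1
    ext i a b
    fin_cases a <;> fin_cases b <;> simp [dilateTangent, lowerTuple] <;> field_simp <;> try simp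
    all_goals ring
  let U : (ι → F) →ₗ[F] (ι → Matrix (Fin 2) (Fin 2) F) :=
    { toFun := upperTuple
      map_add' := fun c c' => by
        ext i a b; fin_cases a <;> fin_cases b <;> simp [upperTuple]
      map_smul' := fun r c => by
        ext i a b; fin_cases a <;> fin_cases b <;> simp [upperTuple] }
  let L : (ι → F) →ₗ[F] (ι → Matrix (Fin 2) (Fin 2) F) :=
    { toFun := lowerTuple
      map_add' := fun c c' => by
        ext i a b; fin_cases a <;> fin_cases b <;> simp [lowerTuple]
      map_smul' := fun r c => by
        ext i a b; fin_cases a <;> fin_cases b <;> simp [lowerTuple] }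
  constructor
  · refine mem_submodule_of_mul_mem ((tangent G d).comap U) hx (y := 1) (by simp) hU
      (fun c hc => ?_) c
    change upperTuple (x * c) ∈ tangent G d
    convert Submodule.smul_mem _ (-(2 : F)⁻¹) (commutator_mem_tangent hH hc) using 1
    ext i a b
    fin_cases a <;> fin_cases b <;>
      simp [U, upperTuple] <;> field_simp <;> ring
  · refine mem_submodule_of_mul_mem ((tangent G d).comap L) hx
      (y := fun i => x i * (x i + 1)) (fun i => mul_ne_zero (hx0 i) fun h => hx1 i
        (eq_neg_of_add_eq_zero_left h)) hL (fun c hc => ?_) c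
    change lowerTuple (x * c) ∈ tangent G d
    convert Submodule.smul_mem _ ((2 : F)⁻¹) (commutator_mem_tangent hH hc) using 1
    ext i a b
    fin_cases a <;> fin_cases b <;>
      simp [L, lowerTuple] <;> field_simp <;> ring

-- A matrix of determinant one with nonzero upper right entry is a product lower · upper · lower of
-- unipotents, and the form survives each of these translations starting from 1 ∈ G.
open MvPolynomial in
theorem eval_eq_zero_of_vanishing [Infinite F] (hG : DilateStable p x G) (h1 : 1 ∈ G) (hd : d ≠ 0)
    (hdp : d * 2 < p - 1) (hp3 : 3 < p) (hx : Function.Injective x) (hx0 : ∀ i, x i ≠ 0)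
    (hx1 : ∀ i, x i ≠ -1) {P : MvPolynomial (ι × Fin 2 × Fin 2) F} (hP : P ∈ vanishing G d)
    {g : ι → Matrix (Fin 2) (Fin 2) F} (hg : ∀ i, (g i).det = 1) (hg' : ∀ i, g i 0 1 ≠ 0) :
    eval (entries g) P = 0 := by
  classical
  have : CharP F p := charP_of_injective_algebraMap (algebraMap (ZMod p) F).injective p
  have hdp' : d < p := by omega
  have T := fun c => tangent_eq_sl2 hG hd hdp hp3 hx hx0 hx1 c
  have hU : ∀ c : ι → F, upperTuple c * upperTuple c = 0 := fun c => by
    ext i a b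
    fin_cases a <;> fin_cases b <;> simp [upperTuple]
  have hL : ∀ c : ι → F, lowerTuple c * lowerTuple c = 0 := fun c => by
    ext i a b
    fin_cases a <;> fin_cases b <;> simp [lowerTuple]
  have key := (rightTranslate_unipotent_mem hdp'
    (T fun i => (g i 1 1 - 1) / g i 0 1).2 (hL _) (rightTranslate_unipotent_mem hdp'
    (T fun i => g i 0 1).1 (hU _) (rightTranslate_unipotent_mem hdp'
    (T fun i => (g i 0 0 - 1) / g i 0 1).2 (hL _) hP))).2 1 h1
  rw [eval_rightTranslate, eval_rightTranslate, eval_rightTranslate, one_mul] at key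
  rw [← key]
  congr 3
  ext i a b
  have h := hg i
  have h' := hg' i
  rw [det_fin_two] at h
  fin_cases a <;> fin_cases b <;>
    simp [upperTuple, lowerTuple, Matrix.mul_apply, Fin.sum_univ_two, Matrix.one_apply] <;>
    field_simp
  all_goals first | ring1 | linear_combination -h
end

end

/-! ### Lower bound for the size of a dilate-stable set. -/

section

variable {ι F : Type*} [Field F]

/-- The entry of a `2 × 2` matrix of determinant one recorded by each of three coordinates. -/
def freeEntry : Fin 3 → Fin 2 × Fin 2 := ![(0, 0), (0, 1), (1, 1)]

-- If G were smaller, some nonzero combination of the (K + 1)^(3n) monomials in the squares of the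
-- free entries, n = `Fintype.card ι`, would vanish on G. Homogenised, it would vanish wherever the
-- free entries are nonzero, but those entries are independent there.
open MvPolynomial in
theorem card_le_of_dilateStable [Fintype ι] [Nonempty ι] [IsAlgClosed F] {p : ℕ}
    [hp : Fact p.Prime] [Algebra (ZMod p) F] {x : ι → F} {G : Set (ι → Matrix (Fin 2) (Fin 2) F)}
    [Finite G] (hG : DilateStable p x G) (h1 : 1 ∈ G) (hdet : ∀ g ∈ G, ∀ i, (g i).det = 1)
    (hx : Function.Injective x) (hx0 : ∀ i, x i ≠ 0) (hx1 : ∀ i, x i ≠ -1) (hp3 : 3 < p) {K : ℕ}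
    (hK0 : K ≠ 0) (hK : 12 * (Fintype.card ι * K) < p - 1) :
    (K + 1) ^ (3 * Fintype.card ι) ≤ Nat.card G := by
  classical
  have : Fintype G := Fintype.ofFinite G
  have hinf : Infinite F := IsAlgClosed.instInfinite
  by_contra! hlt
  let Φ : ((ι × Fin 3 → Fin (K + 1)) → F) →ₗ[F] (G → F) :=
    { toFun := fun c g => ∑ m, c m * ∏ k, (g.1 k.1 (freeEntry k.2).1 (freeEntry k.2).2) ^
        (2 * (m k : ℕ))
      map_add' := fun c c' => by
        ext g
        simp [add_mul, Finset.sum_add_distrib]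
      map_smul' := fun r c => by
        ext g
        simp [mul_assoc, Finset.mul_sum] }
  have hker : LinearMap.ker Φ ≠ ⊥ := by
    apply LinearMap.ker_ne_bot_of_finrank_lt
    rw [Module.finrank_fintype_fun_eq_card, Module.finrank_fintype_fun_eq_card,
      ← Nat.card_eq_fintype_card]
    refine hlt.trans_eq ?_
    simp [mul_comm]
  obtain ⟨c, hc, hc0⟩ := (Submodule.ne_bot_iff _).1 hker
  have hc' : ∀ g ∈ G, ∑ m, c m * ∏ k : ι × Fin 3,
      (g k.1 (freeEntry k.2).1 (freeEntry k.2).2) ^ (2 * (m k : ℕ)) = 0 := fun g hg =>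
    congrFun hc ⟨g, hg⟩
  obtain ⟨i₀⟩ := ‹Nonempty ι›
  let n := 3 * Fintype.card ι * K
  have hm : ∀ m : ι × Fin 3 → Fin (K + 1), ∑ k, (m k : ℕ) ≤ n := fun m => by
    refine (Finset.sum_le_card_nsmul _ _ K fun k _ => by omega).trans_eq ?_
    simp [n, mul_comm]
  -- A determinant, of degree 2 and equal to 1 on the matrices in question, homogenises P. This is
  -- why only even exponents are used.
  let δ : MvPolynomial (ι × Fin 2 × Fin 2) F :=
    X (i₀, 0, 0) * X (i₀, 1, 1) - X (i₀, 0, 1) * X (i₀, 1, 0)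
  have hδ : δ.IsHomogeneous 2 :=
    ((isHomogeneous_X _ _).mul (isHomogeneous_X _ _)).sub
      ((isHomogeneous_X _ _).mul (isHomogeneous_X _ _))
  have hδ1 : ∀ g : ι → Matrix (Fin 2) (Fin 2) F, (∀ i, (g i).det = 1) →
      eval (entries g) δ = 1 := fun g hg => by
    have := hg i₀
    rw [det_fin_two] at this
    simpa [δ, entries] using this
  let P : MvPolynomial (ι × Fin 2 × Fin 2) F := ∑ m : ι × Fin 3 → Fin (K + 1),
    C (c m) * (∏ k, (X (k.1, freeEntry k.2)) ^ (2 * (m k : ℕ))) * δ ^ (n - ∑ k, (m k : ℕ))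
  have hPhom : P.IsHomogeneous (2 * n) := by
    refine IsHomogeneous.sum _ _ _ fun m _ => ?_
    have h1 := IsHomogeneous.prod Finset.univ (fun k : ι × Fin 3 =>
      (X (k.1, freeEntry k.2) : MvPolynomial (ι × Fin 2 × Fin 2) F) ^ (2 * (m k : ℕ)))
      (fun k => 1 * (2 * (m k : ℕ))) (fun k _ => (isHomogeneous_X _ _).pow _)
    have h2 := ((isHomogeneous_C _ (c m)).mul h1).mul (hδ.pow (n - ∑ k, (m k : ℕ)))
    convert h2 using 1
    have := hm m
    simp only [one_mul, ← Finset.mul_sum]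
    omega
  have hPeval : ∀ g : ι → Matrix (Fin 2) (Fin 2) F, (∀ i, (g i).det = 1) →
      eval (entries g) P = ∑ m, c m * ∏ k : ι × Fin 3,
        (g k.1 (freeEntry k.2).1 (freeEntry k.2).2) ^ (2 * (m k : ℕ)) := fun g hg => by
    simp only [P, map_sum, map_mul, map_pow, map_prod, hδ1 g hg, one_pow, mul_one, eval_C, eval_X]
    rfl
  have hP : P ∈ vanishing G (2 * n) :=
    ⟨hPhom, fun g hg => by rw [hPeval g (hdet g hg), hc' g hg]⟩
  let q : MvPolynomial (ι × Fin 3) F := ∑ m : ι × Fin 3 → Fin (K + 1),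
    monomial (Finsupp.equivFunOnFinite.symm fun k => (m k : ℕ)) (c m)
  have hcard := Fintype.card_pos (α := ι) (h := ⟨i₀⟩)
  have hq : q = 0 := by
    refine funext_set (fun k : ι × Fin 3 => {y : F | y ≠ 0}) (fun k => ?_) fun y hy => ?_
    · exact (Set.finite_singleton (0 : F)).infinite_compl
    -- The monomials involve squares of the entries, so a point y is realised by a matrix whose free
    -- entries are square roots of y; the remaining entry is forced by the determinant.
    · have hsq : ∀ k, ∃ z, z ^ 2 = y k := fun k => IsAlgClosed.exists_pow_nat_eq (y k) two_pos
      choose z hz using hsq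
      have hz0 : ∀ k, z k ≠ 0 := fun k h => hy k (Set.mem_univ k) (by rw [← hz, h]; simp)
      let g : ι → Matrix (Fin 2) (Fin 2) F := fun i =>
        !![z (i, 0), z (i, 1); (z (i, 0) * z (i, 2) - 1) / z (i, 1), z (i, 2)]
      have hgdet : ∀ i, (g i).det = 1 := fun i => by
        have := hz0 (i, 1)
        rw [det_fin_two_of]
        field_simp
        ring
      have hn : 2 * n ≠ 0 := by
        simp only [n]
        positivity
      have h2n : 2 * n * 2 < p - 1 := by
        simp only [n]
        refine lt_of_eq_of_lt ?_ hK
        ring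
      have h := eval_eq_zero_of_vanishing hG h1 hn h2n hp3 hx hx0 hx1 hP hgdet
        (fun i => hz0 (i, 1))
      rw [hPeval g hgdet] at h
      rw [map_zero, ← h]
      simp only [q, map_sum, eval_monomial]
      refine Finset.sum_congr rfl fun m _ => ?_
      congr 1
      rw [Finsupp.prod_fintype _ _ (fun k => pow_zero _)]
      refine Finset.prod_congr rfl fun k _ => ?_
      rw [pow_mul, ← hz]
      congr 2
      obtain ⟨i, j⟩ := k
      fin_cases j <;> rfl
  apply hc0
  ext m
  have h := congrArg (coeff (Finsupp.equivFunOnFinite.symm fun k => (m k : ℕ))) hq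
  rw [coeff_zero, coeff_sum, Finset.sum_eq_single m] at h
  · simpa using h
  · intro m' _ hne
    rw [coeff_monomial, if_neg]
    intro h
    apply hne
    ext k
    exact DFunLike.congr_fun h k
  · simp

end

/-! ### Lower unipotents in subgroups of SL₂ over a finite ring. -/

section

variable {R : Type*} [CommRing R]

/-- The element `dilateMatrix s t x` of `SL₂`. -/
def dilateSL (s t : Rˣ) (x : R) : SpecialLinearGroup (Fin 2) R :=
  ⟨dilateMatrix s t x, det_dilateMatrix s t x⟩

/-- The lower unipotent element of `SL₂` with parameter `y`. -/
def lowerSL (y : R) : SpecialLinearGroup (Fin 2) R := ⟨!![1, 0; y, 1], by simp⟩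

theorem lowerSL_add (y z : R) : lowerSL (y + z) = lowerSL y * lowerSL z := by
  apply Subtype.ext
  change _ = !![1, 0; y, 1] * !![1, 0; z, 1]
  simp [lowerSL]

theorem lowerSL_zero : lowerSL (0 : R) = 1 := by
  ext i j
  fin_cases i <;> fin_cases j <;> simp [lowerSL]

theorem lowerSL_neg (y : R) : lowerSL (-y) = (lowerSL y)⁻¹ := by
  rw [eq_inv_iff_mul_eq_one, ← lowerSL_add, neg_add_cancel, lowerSL_zero]

/-- The additive group of parameters of the lower unipotent elements of a subgroup of `SL₂`. -/
def lowerParameters (H : Subgroup (SpecialLinearGroup (Fin 2) R)) : AddSubgroup R where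
  carrier := {y | lowerSL y ∈ H}
  add_mem' := fun h h' => by
    change lowerSL _ ∈ H
    rw [lowerSL_add]
    exact mul_mem h h'
  zero_mem' := by simp [lowerSL_zero]
  neg_mem' := fun h => by
    change lowerSL _ ∈ H
    rw [lowerSL_neg]
    exact inv_mem h

theorem inv_mul_eq_lowerSL {g h : SpecialLinearGroup (Fin 2) R} (h0 : g.1 0 1 = h.1 0 1)
    (h1 : g.1 1 1 = h.1 1 1) : g⁻¹ * h = lowerSL ((g⁻¹ * h).1 1 0) := by
  have hg := g.2
  have hh := h.2
  rw [det_fin_two] at hg hh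
  have e : g⁻¹.1 = !![g.1 1 1, -g.1 0 1; -g.1 1 0, g.1 0 0] := SpecialLinearGroup.SL2_inv_expl g ▸ rfl
  ext i j
  change (g⁻¹.1 * h.1) i j = (lowerSL ((g⁻¹.1 * h.1) 1 0)).1 i j
  rw [e]
  fin_cases i <;> fin_cases j <;> simp [lowerSL, Matrix.mul_apply]
  · rw [h0, h1]
    linear_combination hh
  · rw [h0, h1]
    ring
  · rw [← h0, ← h1]
    linear_combination hg

/-- Two elements of H with the same second column differ by a lower unipotent in H, so each fibre of
the second-column map injects into the parameters. -/
theorem card_le_mul_card_lowerParameters [Finite R] (H : Subgroup (SpecialLinearGroup (Fin 2) R)) :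
    Nat.card H ≤ Nat.card (lowerParameters H) * (Nat.card R * Nat.card R) := by
  classical
  have : Fintype R := Fintype.ofFinite R
  have : Fintype H := Fintype.ofFinite H
  have : Fintype (lowerParameters H) := Fintype.ofFinite _
  simp only [Nat.card_eq_fintype_card]
  let f : H → R × R := fun g => (g.1.1 0 1, g.1.1 1 1)
  have key : (Finset.univ : Finset H).card ≤
      Fintype.card (lowerParameters H) * (Finset.univ.image f).card := by
    refine Finset.card_le_mul_card_image _ _ fun c hc => ?_
    obtain ⟨g, -, rfl⟩ := Finset.mem_image.1 hc
    have hfib : ∀ h : H, f h = f g → (g⁻¹ * h).1 = lowerSL ((g⁻¹ * h).1.1 1 0) := fun h e =>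
      inv_mul_eq_lowerSL (congrArg Prod.fst e).symm (congrArg Prod.snd e).symm
    have hmem : ∀ h : H, f h = f g → (g⁻¹ * h).1.1 1 0 ∈ lowerParameters H := fun h e => by
      change lowerSL _ ∈ H
      rw [← hfib h e]
      exact (g⁻¹ * h).2
    rw [← Finset.card_univ]
    refine Finset.card_le_card_of_injOn
      (fun h => if e : f h = f g then ⟨_, hmem h e⟩ else 0) (fun _ _ => Finset.mem_coe.2 (Finset.mem_univ _)) ?_
    intro h hh h' hh' e
    have hh1 : f h = f g := (Finset.mem_filter.1 hh).2
    have hh1' : f h' = f g := (Finset.mem_filter.1 hh').2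
    simp only [hh1, hh1', dif_pos] at e
    have e' := congrArg Subtype.val e
    have : (g⁻¹ * h) = g⁻¹ * h' := by
      apply Subtype.ext
      rw [hfib h hh1, hfib h' hh1']
      exact congrArg lowerSL e'
    exact mul_left_cancel this
  rw [Finset.card_univ] at key
  refine key.trans (Nat.mul_le_mul_left _ ?_)
  rw [← Fintype.card_prod]
  exact Finset.card_le_univ _

end

/-- The subgroup of `SL₂(R)` generated by the elements `dilateSL s t x` for units `s, t` of
`ℤ/p`. -/
def dilateSubgroup (p : ℕ) {R : Type*} [CommRing R] [Algebra (ZMod p) R] (x : R) :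
    Subgroup (SpecialLinearGroup (Fin 2) R) :=
  Subgroup.closure {g | ∃ s t : (ZMod p)ˣ, g = dilateSL (unitMap p R s) (unitMap p R t) x}

/-- The parameters form an 𝔽_p-subspace L of R. With dim L ≤ 3, H would have at most p³ · p⁸
elements, while its image in SL₂(F)⁴ has at least (p/96)¹². -/
theorem lowerSL_mem_dilateSubgroup {p : ℕ} [hp : Fact p.Prime] (hp1 : 96 ^ 12 < p) {R F : Type*}
    [CommRing R] [Algebra (ZMod p) R] [Module.Finite (ZMod p) R]
    (hR : Module.finrank (ZMod p) R = 4) [Field F] [IsAlgClosed F] [Algebra (ZMod p) F]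
    (ε : Fin 4 → R →ₐ[ZMod p] F) {x : R} (hx : Function.Injective fun i => ε i x)
    (hx0 : ∀ i, ε i x ≠ 0) (hx1 : ∀ i, ε i x ≠ -1) (y : R) : lowerSL y ∈ dilateSubgroup p x := by
  have : Finite R := Module.finite_of_finite (ZMod p)
  set H := dilateSubgroup p x
  let φ : SpecialLinearGroup (Fin 2) R → Fin 4 → Matrix (Fin 2) (Fin 2) F :=
    fun g i => g.1.map (ε i)
  have hφ : ∀ g h, φ (g * h) = φ g * φ h := fun g h => by
    ext1 i
    exact Matrix.map_mul (f := (ε i : R →+* F))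
  let G := φ '' H
  have hG : DilateStable p (fun i => ε i x) G := by
    rintro _ ⟨g, hg, rfl⟩ s t
    refine ⟨g * dilateSL (unitMap p R s) (unitMap p R t) x,
      mul_mem hg (Subgroup.subset_closure ⟨s, t, rfl⟩), ?_⟩
    rw [hφ]
    congr 1
    ext1 i
    refine (dilateMatrix_map (ε i : R →+* F) _ _ _).trans ?_
    congr 1 <;> ext <;> simp
  have h1 : (1 : Fin 4 → Matrix (Fin 2) (Fin 2) F) ∈ G := by
    refine ⟨1, one_mem _, ?_⟩
    ext1 i
    exact Matrix.map_one _ (map_zero _) (map_one _)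
  have hdet : ∀ g ∈ G, ∀ i, (g i).det = 1 := by
    rintro _ ⟨g, -, rfl⟩ i
    have := RingHom.map_det (ε i : R →+* F) g.1
    rw [g.2, map_one] at this
    exact this.symm
  have hlarge : 96 ^ 12 < p := hp1
  have hp2 : 1000 < p := lt_trans (by norm_num) hp1
  -- The largest K with 12 · 4 · K < p - 1.
  have hcard := card_le_of_dilateStable hG h1 hdet hx hx0 hx1 (by omega) (K := (p - 2) / 48)
    (by omega) (by simp only [Fintype.card_fin]; omega)
  have hGH : Nat.card G ≤ Nat.card H := by
    rw [Nat.card_coe_set_eq]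
    exact Set.ncard_image_le (Set.toFinite _)
  have hHP := card_le_mul_card_lowerParameters H
  have hRc : Nat.card R = p ^ 4 := by
    rw [Module.natCard_eq_pow_finrank (K := ZMod p), hR, Nat.card_zmod]
  set L := AddSubgroup.toZModSubmodule p (lowerParameters H) with hL
  have hLc : Nat.card (lowerParameters H) = p ^ Module.finrank (ZMod p) L := by
    have : Nat.card L = Nat.card (ZMod p) ^ Module.finrank (ZMod p) L := Module.natCard_eq_pow_finrank
    rw [Nat.card_zmod] at this
    exact this
  have hfin : 4 ≤ Module.finrank (ZMod p) L := by
    by_contra! h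
    have h3 : p ^ Module.finrank (ZMod p) L ≤ p ^ 3 :=
      Nat.pow_le_pow_right (by omega) (by omega)
    have h4 : ((p - 2) / 48 + 1) ^ 12 ≤ p ^ 11 := by
      calc ((p - 2) / 48 + 1) ^ 12 ≤ Nat.card (lowerParameters H) * (Nat.card R * Nat.card R) := by
            simpa using hcard.trans (hGH.trans hHP)
        _ ≤ p ^ 3 * (p ^ 4 * p ^ 4) := by
            rw [hLc, hRc]
            exact Nat.mul_le_mul_right _ h3
        _ = p ^ 11 := by ring
    have h5 : p ≤ 96 * ((p - 2) / 48 + 1) := by omega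
    have h6 := Nat.pow_le_pow_left h5 12
    rw [mul_pow] at h6
    have h7 : p ^ 11 * p ≤ p ^ 11 * 96 ^ 12 := by
      calc p ^ 11 * p = p ^ 12 := by ring
        _ ≤ 96 ^ 12 * p ^ 11 := h6.trans (Nat.mul_le_mul_left _ h4)
        _ = _ := mul_comm _ _
    have := Nat.le_of_mul_le_mul_left h7 (pow_pos (by omega) _)
    omega
  have hLtop : L = ⊤ := Submodule.eq_top_of_finrank_eq
    (le_antisymm (Submodule.finrank_le L) (hR ▸ hfin))
  have : y ∈ L := hLtop ▸ Submodule.mem_top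
  exact this

/-- M is self-adjoint for the nondegenerate form T, so its eigenvectors form an orthogonal basis
with no isotropic member. In that basis the hypothesis reads Σ μᵢᵏ cᵢ² T(vᵢ, vᵢ) = 0 for all k, and
Vandermonde gives cᵢ = 0. -/
theorem eq_zero_of_forall_dotProduct_pow_eq_zero {F : Type*} [Field F] {n : ℕ}
    {T M : Matrix (Fin n) (Fin n) F} (hT : T.IsSymm) (hdet : T.det ≠ 0) (hTM : (T * M).IsSymm)
    {μ : Fin n → F} (hμ : Function.Injective μ)
    (hM : ∀ i, Module.End.HasEigenvalue (toLin' M) (μ i)) {y : Fin n → F}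
    (hy : ∀ k : ℕ, y ⬝ᵥ (T * M ^ k) *ᵥ y = 0) : y = 0 := by
  choose v hv using fun i => (hM i).exists_hasEigenvector
  have hMv : ∀ i, M *ᵥ v i = μ i • v i := fun i => by
    simpa using (hv i).apply_eq_smul
  have hli := Module.End.eigenvectors_linearIndependent' _ μ hμ v hv
  have hspan : Submodule.span F (Set.range v) = ⊤ :=
    hli.span_eq_top_of_card_eq_finrank' (by simp)
  have hrep : ∀ u, ∃ c : Fin n → F, ∑ i, c i • v i = u := fun u =>
    (Submodule.mem_span_range_iff_exists_fun F).1 (hspan ▸ Submodule.mem_top)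
  have horth : ∀ i j, i ≠ j → v i ⬝ᵥ T *ᵥ v j = 0 := fun i j hij => by
    have h1 : v i ⬝ᵥ (T * M) *ᵥ v j = μ j * (v i ⬝ᵥ T *ᵥ v j) := by
      rw [← mulVec_mulVec, hMv, mulVec_smul, dotProduct_smul, smul_eq_mul]
    have h2 : v i ⬝ᵥ (T * M) *ᵥ v j = μ i * (v i ⬝ᵥ T *ᵥ v j) := by
      rw [dotProduct_mulVec, ← mulVec_transpose, hTM.eq, ← mulVec_mulVec, hMv, mulVec_smul,
        smul_dotProduct, dotProduct_mulVec, ← mulVec_transpose, hT.eq, smul_eq_mul]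
    have h3 : (μ i - μ j) * (v i ⬝ᵥ T *ᵥ v j) = 0 := by
      rw [sub_mul, ← h1, ← h2, sub_self]
    exact (mul_eq_zero.1 h3).resolve_left (sub_ne_zero.2 fun h => hij (hμ h))
  have hnz : ∀ i, v i ⬝ᵥ T *ᵥ v i ≠ 0 := fun i h => by
    have h1 : T *ᵥ v i = 0 := by
      refine dotProduct_eq_zero _ fun u => ?_
      obtain ⟨c, rfl⟩ := hrep u
      rw [dotProduct_comm, sum_dotProduct]
      refine Finset.sum_eq_zero fun j _ => ?_
      rw [smul_dotProduct]
      by_cases hj : j = i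
      · rw [hj, h, smul_zero]
      · rw [horth j i hj, smul_zero]
    exact (hv i).2 (eq_zero_of_mulVec_eq_zero hdet h1)
  obtain ⟨c, rfl⟩ := hrep y
  have hpow : ∀ (k : ℕ) j, (M ^ k) *ᵥ v j = μ j ^ k • v j := fun k j => by
    induction k with
    | zero => simp
    | succ k ih => rw [pow_succ, ← mulVec_mulVec, hMv, mulVec_smul, ih, smul_smul, pow_succ']
  have key : (fun i => c i ^ 2 * (v i ⬝ᵥ T *ᵥ v i)) = 0 := by
    refine eq_zero_of_forall_pow_sum_mul_pow_eq_zero hμ fun k => ?_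
    rw [← hy k, sum_dotProduct]
    refine Finset.sum_congr rfl fun i _ => ?_
    rw [← mulVec_mulVec, mulVec_sum, mulVec_sum, smul_dotProduct, dotProduct_sum,
      Finset.sum_eq_single i]
    · rw [mulVec_smul, hpow, smul_smul, mulVec_smul, dotProduct_smul, smul_eq_mul, smul_eq_mul]
      ring
    · intro j _ hj
      rw [mulVec_smul, hpow, smul_smul, mulVec_smul, dotProduct_smul, horth i j (Ne.symm hj), smul_zero]
    · simp
  refine Finset.sum_eq_zero fun i _ => ?_
  have := (mul_eq_zero.1 (congrFun key i)).resolve_right (hnz i)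
  rw [pow_eq_zero_iff two_ne_zero] at this
  rw [this, zero_smul]

/-! ### From 2 × 2 matrices over R to 8 × 8 symplectic matrices. -/

section Transfer

variable {k : Type*} [Field k] {R : Type*} [CommRing R] [Algebra k R]

/-- Transport of `2 × 2` matrices over `R` to block matrices, twisting by `S`. -/
def blockTransfer (φ : R →ₐ[k] Matrix (Fin 4) (Fin 4) k) (S : Matrix (Fin 4) (Fin 4) k)
    (M : Matrix (Fin 2) (Fin 2) R) : Matrix (Fin 4 ⊕ Fin 4) (Fin 4 ⊕ Fin 4) k :=
  fromBlocks (φ (M 0 0)) (φ (M 0 1) * S) (S⁻¹ * φ (M 1 0)) (S⁻¹ * φ (M 1 1) * S)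

/-- The transfer applies φ entrywise and then conjugates by diag(1, S). -/
theorem blockTransfer_mul (φ : R →ₐ[k] Matrix (Fin 4) (Fin 4) k) {S : Matrix (Fin 4) (Fin 4) k}
    (hS : IsUnit S.det) (M N : Matrix (Fin 2) (Fin 2) R) :
    blockTransfer φ S (M * N) = blockTransfer φ S M * blockTransfer φ S N := by
  have h1 : ∀ m, S * (S⁻¹ * m) = m := fun m => mul_nonsing_inv_cancel_left _ _ hS
  simp only [blockTransfer, fromBlocks_multiply, Matrix.mul_apply, Fin.sum_univ_two, map_add, map_mul]
  congr 1 <;> simp only [Matrix.mul_assoc, h1, Matrix.mul_add, Matrix.add_mul]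

theorem blockTransfer_one (φ : R →ₐ[k] Matrix (Fin 4) (Fin 4) k) {S : Matrix (Fin 4) (Fin 4) k}
    (hS : IsUnit S.det) : blockTransfer φ S 1 = 1 := by
  simp [blockTransfer, nonsing_inv_mul _ hS]

/-- `(4 : k) b⁻¹ a b⁻ᵀ c - 1`. -/
def matrixDiscr (a b c : Matrix (Fin 4) (Fin 4) k) : Matrix (Fin 4) (Fin 4) k :=
  (4 : k) • (b⁻¹ * a * b⁻¹ᵀ * c) - 1

/-- `2 b⁻¹ a b⁻ᵀ`. -/
def twistMatrix (a b : Matrix (Fin 4) (Fin 4) k) : Matrix (Fin 4) (Fin 4) k :=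
  (2 : k) • (b⁻¹ * a * b⁻¹ᵀ)

theorem twistMatrix_isSymm {a : Matrix (Fin 4) (Fin 4) k} (ha : a.IsSymm)
    (b : Matrix (Fin 4) (Fin 4) k) : (twistMatrix a b).IsSymm := by
  simp [Matrix.IsSymm, twistMatrix, transpose_mul, ha.eq, Matrix.mul_assoc]

theorem matrixDiscr_eq (a b c : Matrix (Fin 4) (Fin 4) k) :
    matrixDiscr a b c = (2 : k) • (twistMatrix a b * c) - 1 := by
  rw [matrixDiscr, twistMatrix, Matrix.smul_mul, smul_smul]
  norm_num

/-- With Δ = 2Sc - 1 the lower blocks of g become bΔ and -bS. Up to the twist by S, the quotient of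
two dilates then has entries polynomial in Δ alone. -/
theorem dilation_mul_blockTransfer {a b c : Matrix (Fin 4) (Fin 4) k} (ha : a.IsSymm)
    (hc : c.IsSymm) (hb : IsUnit b.det) (hS : IsUnit (twistMatrix a b).det) (φ : R →ₐ[k] Matrix (Fin 4) (Fin 4) k)
    {x : R} (hx : φ x = matrixDiscr a b c) (s t : kˣ) :
    (dilation t (symplecticElement a b c ha hc hb)).1 =
      (dilation s (symplecticElement a b c ha hc hb)).1 * blockTransfer φ (twistMatrix a b)
        (dilateMatrix (Units.map (algebraMap k R) s) (Units.map (algebraMap k R) t) x) := by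
  set S := twistMatrix a b with hSdef
  have hb1 : ∀ m, b * (b⁻¹ * m) = m := fun m => mul_nonsing_inv_cancel_left _ _ hb
  have hS1 : ∀ m, S⁻¹ * (S * m) = m := fun m => nonsing_inv_mul_cancel_left _ _ hS
  have hS2 : S⁻¹ * S = 1 := nonsing_inv_mul _ hS
  have e1 : (4 : k) • (a * b⁻¹ᵀ * c) - b = (2 : k) • (b * (S * c)) - b := by
    rw [hSdef, twistMatrix]
    simp only [Matrix.smul_mul, Matrix.mul_smul, smul_smul, Matrix.mul_assoc, hb1]
    norm_num
  have e2 : -(2 : k) • (a * b⁻¹ᵀ) = -(b * S) := by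
    rw [hSdef, twistMatrix]
    simp only [Matrix.mul_smul, Matrix.mul_assoc, hb1, neg_smul]
  have hs := s.ne_zero
  have ht := t.ne_zero
  have hφ : ∀ r : k, φ (algebraMap k R r) = r • 1 := fun r => by
    rw [AlgHom.commutes, Algebra.algebraMap_eq_smul_one]
  rw [matrixDiscr_eq, ← hSdef] at hx
  simp only [dilation, symplecticElement, MonoidHom.coe_mk, OneHom.coe_mk, e1, e2,
    toBlocks_fromBlocks₁₁, toBlocks_fromBlocks₁₂, toBlocks_fromBlocks₂₁, toBlocks_fromBlocks₂₂,
    blockTransfer, fromBlocks_multiply, dilateMatrix, of_apply, cons_val', cons_val_zero,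
    cons_val_one, cons_val_fin_one, map_add, map_mul, map_sub, map_one, hx, ← map_inv,
    Units.coe_map, MonoidHom.coe_coe, hφ, Units.smul_def, Units.val_inv_eq_inv_val]
  congr 1 <;>
    simp only [Matrix.mul_add, Matrix.add_mul, Matrix.smul_mul,
      Matrix.mul_smul, Matrix.mul_one, Matrix.one_mul, Matrix.mul_assoc, hS1, hS2, smul_sub,
      smul_smul, mul_sub, sub_mul, Matrix.neg_mul, smul_neg]
  all_goals
    match_scalars <;> field_simp <;> ring

end Transfer

/-! ### Lower unipotents in Γ_p. -/

section Unipotents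

variable {p : ℕ} [hp : Fact p.Prime] {a b c : Matrix (Fin 4) (Fin 4) (ZMod p)}

/-- The ring is 𝔽_p[X]/(χ): it has dimension 4, acts through Δ by Cayley–Hamilton, and maps to F by
evaluation at each root. The lower unipotent with parameter q transfers to l(S⁻¹q(Δ)). -/
theorem exists_lower_mem_dilateGroup {F : Type*} [Field F] [IsAlgClosed F] [Algebra (ZMod p) F]
    (hp1 : 96 ^ 12 < p) (ha : a.IsSymm) (hc : c.IsSymm)
    (hb : IsUnit b.det) (hS : IsUnit (twistMatrix a b).det) {μ : Fin 4 → F}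
    (hμ : Function.Injective μ) (hroot : ∀ i, Polynomial.aeval (μ i) (matrixDiscr a b c).charpoly = 0)
    (hμ0 : ∀ i, μ i ≠ 0) (hμ1 : ∀ i, μ i ≠ -1) (q : Polynomial (ZMod p)) :
    ∃ hW : ((twistMatrix a b)⁻¹ * Polynomial.aeval (matrixDiscr a b c) q).IsSymm,
      l _ hW ∈ dilateGroup (symplecticElement a b c ha hc hb) := by
  set χ := (matrixDiscr a b c).charpoly with hχ
  let I := Ideal.span {χ}
  let φ : (Polynomial (ZMod p) ⧸ I) →ₐ[ZMod p] Matrix (Fin 4) (Fin 4) (ZMod p) :=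
    Ideal.Quotient.liftₐ I (Polynomial.aeval (matrixDiscr a b c)) fun r hr => by
      obtain ⟨u, rfl⟩ := Ideal.mem_span_singleton.1 hr
      rw [map_mul, aeval_self_charpoly, zero_mul]
  let ε : Fin 4 → (Polynomial (ZMod p) ⧸ I) →ₐ[ZMod p] F := fun i =>
    Ideal.Quotient.liftₐ I (Polynomial.aeval (μ i)) fun r hr => by
      obtain ⟨u, rfl⟩ := Ideal.mem_span_singleton.1 hr
      rw [map_mul, hroot, zero_mul]
  let x : Polynomial (ZMod p) ⧸ I := Ideal.Quotient.mk I Polynomial.X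
  have hε : ∀ i, ε i x = μ i := fun i => Polynomial.aeval_X (μ i)
  have hx : φ x = matrixDiscr a b c := Polynomial.aeval_X _
  have hR : Module.finrank (ZMod p) (Polynomial (ZMod p) ⧸ I) = 4 := by
    rw [finrank_quotient_span_eq_natDegree, charpoly_natDegree_eq_dim, Fintype.card_fin]
  have : Module.Finite (ZMod p) (Polynomial (ZMod p) ⧸ I) :=
    Module.finite_of_finrank_pos (by omega)
  have hmem := lowerSL_mem_dilateSubgroup hp1 hR ε (x := x) (by simpa only [hε] using hμ)
    (fun i => by rw [hε]; exact hμ0 i) (fun i => by rw [hε]; exact hμ1 i) (Ideal.Quotient.mk I q)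
  have htransfer : ∀ M ∈ dilateSubgroup p x,
      ∃ γ ∈ dilateGroup (symplecticElement a b c ha hc hb),
        γ.1 = blockTransfer φ (twistMatrix a b) M.1 := by
    intro M hM
    induction hM using Subgroup.closure_induction with
    | mem M hM =>
      obtain ⟨s, t, rfl⟩ := hM
      refine ⟨_, Subgroup.subset_closure ⟨s, t, rfl⟩, ?_⟩
      have h := dilation_mul_blockTransfer ha hc hb hS φ hx s t
      change (((dilation s (symplecticElement a b c ha hc hb))⁻¹ : Sp (ZMod p)).1 *
        (dilation t (symplecticElement a b c ha hc hb)).1) = _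
      rw [h, ← mul_assoc, ← Submonoid.coe_mul, inv_mul_cancel, Submonoid.coe_one, one_mul]
      rfl
    | one => exact ⟨1, one_mem _, (blockTransfer_one φ hS).symm⟩
    | mul M N _ _ hM hN =>
      obtain ⟨γ, hγ, eγ⟩ := hM
      obtain ⟨δ, hδ, eδ⟩ := hN
      exact ⟨γ * δ, mul_mem hγ hδ, by
        rw [Submonoid.coe_mul, eγ, eδ]
        exact (blockTransfer_mul φ hS _ _).symm⟩
    | inv M _ hM =>
      obtain ⟨γ, hγ, eγ⟩ := hM
      refine ⟨γ⁻¹, inv_mem hγ, ?_⟩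
      have h1 : (γ⁻¹ : Sp (ZMod p)).1 * γ.1 = 1 := by
        rw [← Submonoid.coe_mul, inv_mul_cancel, Submonoid.coe_one]
      have h2 : γ.1 * blockTransfer φ (twistMatrix a b) (M⁻¹).1 = 1 := by
        have h3 : M.1 * (M⁻¹).1 = 1 := by
          change (M * M⁻¹).1 = 1
          rw [mul_inv_cancel]
          rfl
        rw [eγ, ← blockTransfer_mul φ hS, h3, blockTransfer_one φ hS]
      exact left_inv_eq_right_inv h1 h2
  obtain ⟨γ, hγ, eγ⟩ := htransfer _ hmem
  have e : γ.1 = fromBlocks 1 0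
      ((twistMatrix a b)⁻¹ * Polynomial.aeval (matrixDiscr a b c) q) 1 := by
    rw [eγ]
    have hq : φ (Ideal.Quotient.mk I q) = Polynomial.aeval (matrixDiscr a b c) q := rfl
    simp [blockTransfer, lowerSL, hq, nonsing_inv_mul _ hS]
  -- Symmetry of S⁻¹q(Δ) is read off from the transferred matrix being symplectic.
  have hsymm := γ.2
  rw [e, SymplecticGroup.fromBlocks_mem_iff] at hsymm
  have hW := hsymm.1
  rw [transpose_one, Matrix.one_mul, Matrix.mul_one] at hW
  refine ⟨hW.symm, ?_⟩
  have : l _ hW.symm = γ := Subtype.ext e.symm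
  rw [this]
  exact hγ

end Unipotents

/-! ### Relations among the generators of the symplectic group. -/

section Weil

variable {R : Type*} [CommRing R]

theorem l_add (W W' : Matrix (Fin 4) (Fin 4) R) (hW : W.IsSymm) (hW' : W'.IsSymm) :
    l (W + W') (hW.add hW') = l W hW * l W' hW' := by
  apply Subtype.ext
  change fromBlocks 1 0 (W + W') 1 = fromBlocks 1 0 W 1 * fromBlocks 1 0 W' 1
  simp [fromBlocks_multiply]

theorem dilation_l (r : Rˣ) (W : Matrix (Fin 4) (Fin 4) R) (hW : W.IsSymm) :
    dilation r (l W hW) = l ((r : R) • W) (hW.smul _) := by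
  apply Subtype.ext
  simp [dilation, l, Units.smul_def]

theorem dilation_dilation (r s : Rˣ) (g : Sp R) : dilation r (dilation s g) = dilation (r * s) g := by
  apply Subtype.ext
  simp [dilation, mul_smul, mul_comm]

/-- The scalar element of `GL₄`. -/
def scalarGL (u : Rˣ) : GL (Fin 4) R :=
  ⟨(u : R) • 1, ((u⁻¹ : Rˣ) : R) • 1, by simp [smul_smul], by simp [smul_smul]⟩

theorem scalar_mul_l (u : Rˣ) (W : Matrix (Fin 4) (Fin 4) R) (hW : W.IsSymm) :
    s (scalarGL u) * l (((u : R) * u) • W) (hW.smul _) = l W hW * s (scalarGL u) := by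
  apply Subtype.ext
  change fromBlocks _ _ _ _ * fromBlocks _ _ _ _ = fromBlocks _ _ _ _ * fromBlocks _ _ _ _
  have h : ((scalarGL u)⁻¹ : GL (Fin 4) R).1 = ((u⁻¹ : Rˣ) : R) • 1 := rfl
  have h' : (scalarGL u).1 = (u : R) • 1 := rfl
  simp [fromBlocks_multiply, h, h', smul_smul]

/-- The element `t⁻¹ b⁻ᵀ` of `GL₄`. -/
def dilateGL {b : Matrix (Fin 4) (Fin 4) R} (hb : IsUnit b.det) (t : Rˣ) : GL (Fin 4) R :=
  ⟨(t⁻¹ : Rˣ) • b⁻¹ᵀ, t • bᵀ,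
    by simp [← transpose_mul, mul_nonsing_inv _ hb],
    by simp [← transpose_mul, nonsing_inv_mul _ hb]⟩

/-- This factorisation lets the three defining formulas of a Weil representation compute the action
of each dilate. -/
theorem dilation_symplecticElement {a b c : Matrix (Fin 4) (Fin 4) R} (ha : a.IsSymm)
    (hc : c.IsSymm) (hb : IsUnit b.det) (t : Rˣ) :
    dilation t (symplecticElement a b c ha hc hb) =
      l ((-2 * t : R) • a) (ha.smul _) * (s (dilateGL hb t) * (J * l ((-2 * t : R) • c) (hc.smul _))) := by
  apply Subtype.ext
  change fromBlocks _ _ _ _ = fromBlocks _ _ _ _ * (fromBlocks _ _ _ _ * (fromBlocks _ _ _ _ * fromBlocks _ _ _ _))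
  have h : ((dilateGL hb t)⁻¹ : GL (Fin 4) R).1 = t • bᵀ := rfl
  have h' : (dilateGL hb t).1 = (t⁻¹ : Rˣ) • b⁻¹ᵀ := rfl
  have ht := t.mul_inv
  simp only [h, h', symplecticElement, toBlocks_fromBlocks₁₁, toBlocks_fromBlocks₁₂,
    toBlocks_fromBlocks₂₁, toBlocks_fromBlocks₂₂, fromBlocks_multiply, Units.smul_def]
  congr 1 <;> simp [Matrix.mul_assoc, smul_smul, sub_eq_add_neg] <;> match_scalars <;> ring_nf
  all_goals simp

end Weil

/-! ### Invariant vectors of a Weil representation. -/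

section WeilRep

variable {p : ℕ} [hp : Fact p.Prime] {ρ : UnitaryRep p}

theorem isometry_mul_apply (e e' : L2 p ≃ₗᵢ[ℂ] L2 p) (f : L2 p) : (e * e') f = e (e' f) := rfl

/-- The phase is trivial on lower unipotents. Evaluation at 0 shows that it is additive in W, and
conjugation by the scalar 2 shows that it agrees on 4V and V. Hence it is 1 on 3V, and 3 is
invertible. -/
theorem IsWeilRep.apply_l (hρ : IsWeilRep p ρ) (hp3 : 3 < p) (W : Matrix (Fin 4) (Fin 4) (ZMod p))
    (hW : W.IsSymm) (f : L2 p) (x : Fin 4 → ZMod p) :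
    ρ (l W hW) f x = ZMod.stdAddChar (-(2 : ZMod p)⁻¹ * (x ⬝ᵥ W *ᵥ x)) * f x := by
  obtain ⟨ξ, hs, -, hl⟩ := hρ
  have hnat : ∀ n : ℕ, 0 < n → n < p → (n : ZMod p) ≠ 0 := fun n h0 hn h => by
    rw [ZMod.natCast_eq_zero_iff] at h
    have := Nat.le_of_dvd h0 h
    omega
  have h3 : (3 : ZMod p) ≠ 0 := by exact_mod_cast hnat 3 (by omega) hp3
  have h2 : (2 : ZMod p) ≠ 0 := by exact_mod_cast hnat 2 (by omega) (by omega)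
  let δ : L2 p := WithLp.toLp 2 fun _ => 1
  have hδl : ∀ (V : Matrix (Fin 4) (Fin 4) (ZMod p)) (hV : V.IsSymm) (f : L2 p),
      ρ (l V hV) f 0 = ξ (l V hV) * f 0 := fun V hV f => by
    rw [hl, zero_dotProduct, mul_zero, AddChar.map_zero_eq_one, one_mul]
  have hδs : ∀ (E : GL (Fin 4) (ZMod p)) (f : L2 p), ρ (s E) f 0 = ξ (s E) * f 0 := fun E f => by
    rw [hs, mulVec_zero]
  have hδ : δ 0 = 1 := rfl
  have hadd : ∀ (V V' : Matrix (Fin 4) (Fin 4) (ZMod p)) (hV : V.IsSymm) (hV' : V'.IsSymm),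
      (ξ (l (V + V') (hV.add hV')) : ℂ) = ξ (l V hV) * ξ (l V' hV') := fun V V' hV hV' => by
    have h := hδl _ (hV.add hV') δ
    rw [l_add _ _ hV hV', map_mul, isometry_mul_apply, hδl, hδl, ← l_add, hδ, mul_one, mul_one] at h
    exact h.symm
  let u : (ZMod p)ˣ := Units.mk0 2 h2
  have hconj : ∀ (V : Matrix (Fin 4) (Fin 4) (ZMod p)) (hV : V.IsSymm),
      (ξ (l (((u : ZMod p) * u) • V) (hV.smul _)) : ℂ) = ξ (l V hV) := fun V hV => by
    have h := congrArg (fun g => ρ g δ 0) (scalar_mul_l u V hV)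
    simp only [map_mul, isometry_mul_apply, hδl, hδs, hδ, mul_one] at h
    rw [mul_comm] at h
    exact mul_right_cancel₀ (Circle.coe_ne_zero _) h
  have hthree : ∀ (V : Matrix (Fin 4) (Fin 4) (ZMod p)) (hV : V.IsSymm),
      (ξ (l ((3 : ZMod p) • V) (hV.smul _)) : ℂ) = 1 := fun V hV => by
    have h := hconj V hV
    have e : ((u : ZMod p) * u) • V = (3 : ZMod p) • V + V := by
      simp only [u, Units.val_mk0]
      module
    simp only [e] at h
    rw [hadd _ _ (hV.smul _) hV] at h
    exact mul_right_cancel₀ (Circle.coe_ne_zero _) (h.trans (one_mul _).symm)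
  have hone := hthree ((3 : ZMod p)⁻¹ • W) (hW.smul _)
  simp only [smul_smul, mul_inv_cancel₀ h3, one_smul] at hone
  rw [hl, hone, one_mul]

theorem stdAddChar_mul_eq_one {u : ZMod p} (h : ∀ t : ZMod p, (ZMod.stdAddChar (t * u) : ℂ) = 1) :
    u = 0 := by
  have h1 := h 1
  rw [one_mul] at h1
  exact ZMod.injective_stdAddChar (h1.trans (AddChar.map_zero_eq_one _).symm)

theorem eq_zero_of_twist_invariant {a b c : Matrix (Fin 4) (Fin 4) (ZMod p)} {F : Type*} [Field F]
    [IsAlgClosed F] [Algebra (ZMod p) F] (hp1 : 96 ^ 12 < p) (ha : a.IsSymm) (hc : c.IsSymm)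
    (ha0 : a.det ≠ 0) (hb : IsUnit b.det) {μ : Fin 4 → F} (hμ : Function.Injective μ)
    (hroot : ∀ i, Polynomial.aeval (μ i) (matrixDiscr a b c).charpoly = 0)
    (hμ0 : ∀ i, μ i ≠ 0) (hμ1 : ∀ i, μ i ≠ -1) (hρ : IsWeilRep p ρ) (r : (ZMod p)ˣ) (f : L2 p)
    (hf : ∀ γ ∈ dilateGroup (symplecticElement a b c ha hc hb), ρ.twist r γ f = f) : f = 0 := by
  have hp2 : 1000 < p := lt_trans (by norm_num) hp1
  have h2 : (2 : ZMod p) ≠ 0 := fun h => by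
    have h' : ((2 : ℕ) : ZMod p) = 0 := by exact_mod_cast h
    rw [ZMod.natCast_eq_zero_iff] at h'
    have := Nat.le_of_dvd (by norm_num) h'
    omega
  have hS : IsUnit (twistMatrix a b).det := by
    rw [twistMatrix, det_smul, det_mul, det_mul, det_transpose, det_nonsing_inv]
    have : IsUnit (Ring.inverse b.det) := hb.ringInverse
    exact ((isUnit_iff_ne_zero.2 h2).pow _).mul ((this.mul (isUnit_iff_ne_zero.2 ha0)).mul this)
  have hsupp : ∀ y, f y ≠ 0 → y = 0 := fun y hy => by
    have hT : ∀ k : ℕ, y ⬝ᵥ ((twistMatrix a b)⁻¹ * matrixDiscr a b c ^ k) *ᵥ y = 0 := fun k => by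
      have h : ∀ t : ZMod p, (ZMod.stdAddChar (t *
          (y ⬝ᵥ ((twistMatrix a b)⁻¹ * matrixDiscr a b c ^ k) *ᵥ y)) : ℂ) = 1 := fun t => by
        -- The coefficient -2t/r cancels the -1/2 of the modulation and the factor r of the twist,
        -- leaving the phase e_p(t · form).
        obtain ⟨hW, hmem⟩ := exists_lower_mem_dilateGroup hp1 ha hc hb hS hμ hroot hμ0 hμ1
          (Polynomial.C (-(2 * t) * (r⁻¹ : (ZMod p)ˣ)) * Polynomial.X ^ k)
        have h1 := congrArg (fun f : L2 p => f y) (hf _ hmem)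
        simp only [UnitaryRep.twist, MonoidHom.comp_apply, dilation_l] at h1
        rw [hρ.apply_l (by omega)] at h1
        have h3 := mul_right_cancel₀ hy (h1.trans (one_mul _).symm)
        rw [← h3]
        congr 1
        rw [map_mul, Polynomial.aeval_C, map_pow, Polynomial.aeval_X,
          Algebra.algebraMap_eq_smul_one, Matrix.smul_mul, Matrix.one_mul, Matrix.mul_smul, smul_smul,
          smul_mulVec, dotProduct_smul, smul_eq_mul]
        have hr := r.mul_inv
        field_simp
        rw [mul_assoc _ (r : ZMod p), hr, mul_one]
      exact stdAddChar_mul_eq_one h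
    let ι := algebraMap (ZMod p) F
    have hzero : (ι ∘ y) = 0 := by
      refine eq_zero_of_forall_dotProduct_pow_eq_zero
        (T := ((twistMatrix a b)⁻¹).map ι) (M := (matrixDiscr a b c).map ι) ?_ ?_ ?_ hμ
        (fun i => ?_) fun k => ?_
      · have : ((twistMatrix a b)⁻¹).IsSymm := by
          rw [Matrix.IsSymm, transpose_nonsing_inv, (twistMatrix_isSymm ha b).eq]
        exact this.map _
      · have h := ((twistMatrix a b).isUnit_nonsing_inv_det hS).map ι
        rw [RingHom.map_det] at h
        exact h.ne_zero
      · obtain ⟨hW, -⟩ := exists_lower_mem_dilateGroup hp1 ha hc hb hS hμ hroot hμ0 hμ1 Polynomial.X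
        rw [Polynomial.aeval_X] at hW
        rw [← Matrix.map_mul]
        exact hW.map _
      · rw [Module.End.hasEigenvalue_iff_isRoot_charpoly, Matrix.charpoly_toLin', charpoly_map,
          Polynomial.IsRoot, Polynomial.eval_map]
        exact hroot i
      · have e : ((twistMatrix a b)⁻¹ * matrixDiscr a b c ^ k).map ι *ᵥ (ι ∘ y) =
            ι ∘ (((twistMatrix a b)⁻¹ * matrixDiscr a b c ^ k) *ᵥ y) :=
          funext fun i => (RingHom.map_mulVec ι _ _ i).symm
        rw [← Matrix.map_pow, ← Matrix.map_mul, e, ← RingHom.map_dotProduct, hT k, map_zero]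
    ext i
    exact ι.injective ((congrFun hzero i).trans (map_zero ι).symm)
  have hf0 : f 0 = 0 := by
    by_contra hf0
    have hρ' := hρ
    obtain ⟨ξ, hs, hJ, -⟩ := hρ'
    have hp0 : (p : ℂ) ≠ 0 := Nat.cast_ne_zero.2 hp.out.ne_zero
    -- As f is supported at 0, l(-2tc) fixes it and J makes it constant, which s preserves up to
    -- phase; l(-2ta) then produces the chirp.
    have hexp : ∀ t : (ZMod p)ˣ, ∃ C : ℂ, C ≠ 0 ∧ ∀ x,
        ρ (dilation t (symplecticElement a b c ha hc hb)) f x =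
          ZMod.stdAddChar ((t : ZMod p) * (x ⬝ᵥ a *ᵥ x)) * C := fun t => by
      refine ⟨ξ (s (dilateGL hb t)) * (ξ J * ((p : ℂ) ^ 2 * (f 0 / (p : ℂ) ^ 4))), ?_, fun x => ?_⟩
      · refine mul_ne_zero (Circle.coe_ne_zero _) (mul_ne_zero (Circle.coe_ne_zero _)
          (mul_ne_zero (pow_ne_zero _ hp0) (div_ne_zero hf0 (pow_ne_zero _ hp0))))
      · rw [dilation_symplecticElement, map_mul, isometry_mul_apply,
          hρ.apply_l (by omega), map_mul ρ (s _), isometry_mul_apply, hs, map_mul ρ J,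
          isometry_mul_apply, hJ]
        congr 2
        · rw [smul_mulVec, dotProduct_smul, smul_eq_mul]
          field_simp
        · congr 3
          rw [Finset.sum_eq_single 0]
          · rw [hρ.apply_l (by omega)]
            simp
          · intro y _ hy
            rw [hρ.apply_l (by omega), not_not.1 (mt (hsupp y) hy)]
            simp
          · simp
    have heq : ∀ t : (ZMod p)ˣ, ρ (dilation (r * t) (symplecticElement a b c ha hc hb)) f =
        ρ (dilation r (symplecticElement a b c ha hc hb)) f := fun t => by
      have h1 := hf _ (Subgroup.subset_closure ⟨1, t, rfl⟩)
      simp only [UnitaryRep.twist, MonoidHom.comp_apply] at h1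
      rw [map_mul, map_inv, dilation_dilation, dilation_dilation, mul_one, map_mul, map_inv,
        isometry_mul_apply] at h1
      have h4 := congrArg (ρ (dilation r (symplecticElement a b c ha hc hb))) h1
      rw [← isometry_mul_apply, ← isometry_mul_apply, mul_inv_cancel, one_mul] at h4
      exact h4
    obtain ⟨C, hC, hCx⟩ := hexp r
    -- Compare the dilates by r and 2r: x = 0 matches the constants, and the phases then give r xᵀax
    -- = 2r xᵀax.
    obtain ⟨C', hC', hCx'⟩ := hexp (r * Units.mk0 2 h2)
    have hCC : C' = C := by
      have h1 := hCx 0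
      have h1' := hCx' 0
      rw [heq, h1] at h1'
      simpa using h1'.symm
    have hiso : ∀ x, x ⬝ᵥ a *ᵥ x = 0 := fun x => by
      have h1 := hCx x
      have h1' := hCx' x
      rw [heq, h1, hCC] at h1'
      have h5 := ZMod.injective_stdAddChar (mul_right_cancel₀ hC h1')
      rw [Units.val_mul, Units.val_mk0, mul_assoc] at h5
      have h6 := mul_left_cancel₀ r.ne_zero h5
      linear_combination -h6
    apply ha0
    have : a = 0 := by
      ext i j
      have h1 := hiso (Pi.single i 1 + Pi.single j 1)
      have h3 := hiso (Pi.single i 1)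
      have h4 := hiso (Pi.single j 1)
      have hij : a j i = a i j := ha.apply i j
      simp only [mulVec_add, dotProduct_add, add_dotProduct, mulVec_single_one, single_one_dotProduct,
        col_apply] at h1 h3 h4
      have h5 : 2 * a i j = 0 := by linear_combination h1 - h3 - h4 - hij
      simpa using (mul_eq_zero.1 h5).resolve_left h2
    rw [this, det_zero]
  ext y
  by_cases hy : f y = 0
  · exact hy
  · rw [hsupp y hy]
    exact hf0

end WeilRep

/-! ### Genericity modulo large primes. -/

theorem aeval_charpoly_smul {k F : Type*} [Field k] [Field F] [Algebra k F]
    (M : Matrix (Fin 4) (Fin 4) k) (c : k) (μ : F) :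
    Polynomial.aeval (algebraMap k F c * μ) (c • M).charpoly =
      algebraMap k F c ^ 4 * Polynomial.aeval μ M.charpoly := by
  rw [Polynomial.aeval_def, Polynomial.aeval_def, Polynomial.eval₂_eq_eval_map,
    Polynomial.eval₂_eq_eval_map, ← charpoly_map, ← charpoly_map, eval_charpoly, eval_charpoly]
  have : scalar (Fin 4) (algebraMap k F c * μ) - (c • M).map (algebraMap k F) =
      algebraMap k F c • (scalar (Fin 4) μ - M.map (algebraMap k F)) := by
    ext i j
    by_cases h : i = j <;> simp [h, mul_sub]
  rw [this, det_smul, Fintype.card_fin]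

namespace QuadForm

variable (Q : QuadForm)

/-- The integral matrix `(det b)² Δ`. -/
def intDiscr : Matrix (Fin 4) (Fin 4) ℤ :=
  (4 : ℤ) • (Q.b.adjugate * Q.a * Q.b.adjugateᵀ * Q.c) - (Q.b.det ^ 2) • 1

theorem intDiscr_map {k : Type*} [Field k] (hd : ((Q.b.det : ℤ) : k) ≠ 0) :
    Q.intDiscr.map (Int.castRingHom k) = ((Q.b.det : ℤ) : k) ^ 2 •
      matrixDiscr (Q.a.map (Int.castRingHom k)) (Q.b.map (Int.castRingHom k))
        (Q.c.map (Int.castRingHom k)) := by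
  have hdet : (Q.b.map (Int.castRingHom k)).det = (Q.b.det : k) :=
    (RingHom.map_det (Int.castRingHom k) Q.b).symm
  have hadj : (Q.b.map (Int.castRingHom k)).adjugate = Q.b.adjugate.map (Int.castRingHom k) :=
    (RingHom.map_adjugate (Int.castRingHom k) Q.b).symm
  rw [matrixDiscr, inv_def, hdet, hadj, Ring.inverse_eq_inv', transpose_smul]
  simp only [Matrix.smul_mul, Matrix.mul_smul, smul_sub, smul_smul]
  have e : ((Q.b.det : ℤ) : k) ^ 2 * (4 * (((Q.b.det : ℤ) : k)⁻¹ * ((Q.b.det : ℤ) : k)⁻¹)) = 4 := by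
    field_simp
  rw [e, intDiscr, Matrix.map_sub _ (map_sub _), Matrix.map_smulₛₗ (Int.castRingHom k) (Int.castRingHom k),
    Matrix.map_smulₛₗ (Int.castRingHom k) (Int.castRingHom k), Matrix.map_mul, Matrix.map_mul, Matrix.map_mul,
    transpose_map, Matrix.map_one _ (map_zero _) (map_one _)]
  · simp
  · exact fun a => by simp
  · exact fun a => by simp

theorem aeval_intDiscr {k F : Type*} [Field k] [Field F] [Algebra k F]
    (hd : ((Q.b.det : ℤ) : k) ≠ 0) (μ : F) :
    (Q.intDiscr.charpoly.map (Int.castRingHom F)).eval (((Q.b.det : ℤ) : F) ^ 2 * μ) =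
      ((Q.b.det : ℤ) : F) ^ 8 * Polynomial.aeval μ
        (matrixDiscr (Q.a.map (Int.castRingHom k)) (Q.b.map (Int.castRingHom k))
          (Q.c.map (Int.castRingHom k))).charpoly := by
  have h := aeval_charpoly_smul (matrixDiscr (Q.a.map (Int.castRingHom k))
    (Q.b.map (Int.castRingHom k)) (Q.c.map (Int.castRingHom k))) (((Q.b.det : ℤ) : k) ^ 2) μ
  rw [← Q.intDiscr_map hd, charpoly_map, Polynomial.aeval_def, Polynomial.eval₂_map] at h
  simp only [map_pow, map_intCast, ← pow_mul] at h
  rw [← h, Polynomial.eval_map]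
  congr 1
  exact Subsingleton.elim _ _

end QuadForm

theorem eval_map_intCast (R : Type*) [CommRing R] (P : Polynomial ℤ) (n : ℤ) :
    (P.map (Int.castRingHom R)).eval (n : R) = ((P.eval n : ℤ) : R) := by
  simp [Polynomial.eval_intCast_map]

theorem exists_bezout_of_separable {P : Polynomial ℤ}
    (hP : (P.map (Int.castRingHom ℚ)).Separable) :
    ∃ m : ℤ, m ≠ 0 ∧ ∃ u v : Polynomial ℤ, u * P + v * P.derivative = Polynomial.C m := by
  obtain ⟨u, v, h⟩ := hP
  have hint : ∀ q : Polynomial ℚ, ∃ n : ℤ, n ≠ 0 ∧ ∃ r : Polynomial ℤ,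
      r.map (Int.castRingHom ℚ) = Polynomial.C (n : ℚ) * q := fun q => by
    obtain ⟨n, hn0, hn⟩ := IsLocalization.integerNormalization_spec (nonZeroDivisors ℤ) q
    refine ⟨n, nonZeroDivisors.ne_zero hn0, _, hn.trans ?_⟩
    ext i
    simp
  obtain ⟨n, hn, r, hr⟩ := hint u
  obtain ⟨n', hn', r', hr'⟩ := hint v
  refine ⟨n * n', mul_ne_zero hn hn', Polynomial.C n' * r, Polynomial.C n * r', ?_⟩
  apply Polynomial.map_injective (Int.castRingHom ℚ) Int.cast_injective
  simp only [Polynomial.map_add, Polynomial.map_mul, hr, hr', Polynomial.map_C, Int.coe_castRingHom,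
    ← Polynomial.derivative_map, Polynomial.C_mul]
  linear_combination (Polynomial.C (n : ℚ) * Polynomial.C (n' : ℚ)) * h

namespace QuadForm

variable {Q : QuadForm}

/-- Scaling by (det b)² makes Δ integral, so one integer polynomial χ governs the eigenvalues over ℚ
and modulo p. Every requirement becomes the nonvanishing modulo p of a fixed nonzero integer. -/
theorem IsGeneric.exists_prime_bound (hQ : Q.IsGeneric) :
    ∃ p₀ : ℕ, ∀ (p : ℕ) [Fact p.Prime], p₀ ≤ p →
      ((Q.a.det : ℤ) : ZMod p) ≠ 0 ∧ ((Q.b.det : ℤ) : ZMod p) ≠ 0 ∧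
      ∃ μ : Fin 4 → AlgebraicClosure (ZMod p), Function.Injective μ ∧
        (∀ i, Polynomial.aeval (μ i) (matrixDiscr (Q.a.map (Int.castRingHom (ZMod p)))
          (Q.b.map (Int.castRingHom (ZMod p))) (Q.c.map (Int.castRingHom (ZMod p)))).charpoly = 0) ∧
        (∀ i, μ i ≠ 0) ∧ ∀ i, μ i ≠ -1 := by
  obtain ⟨hab, hcard, h0, h1⟩ := hQ
  rw [det_mul] at hab
  have ha := left_ne_zero_of_mul hab
  have hb := right_ne_zero_of_mul hab
  have hbQ : ((Q.b.det : ℤ) : ℚ) ≠ 0 := Int.cast_ne_zero.2 hb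
  have hbC : ((Q.b.det : ℤ) : AlgebraicClosure ℚ) ≠ 0 := Int.cast_ne_zero.2 hb
  set χ := Q.intDiscr.charpoly with hχ
  have heig : ∀ μ, μ ∈ Q.discrEigenvalues ↔
      (χ.map (Int.castRingHom (AlgebraicClosure ℚ))).IsRoot
        (((Q.b.det : ℤ) : AlgebraicClosure ℚ) ^ 2 * μ) := fun μ => by
    rw [discrEigenvalues, Set.mem_ofPred_eq, Module.End.hasEigenvalue_iff_isRoot_charpoly,
      charpoly_toLin', charpoly_map, Polynomial.IsRoot, Polynomial.IsRoot, hχ, Q.aeval_intDiscr hbQ,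
      mul_eq_zero, or_iff_right (pow_ne_zero _ hbC), Polynomial.eval_map, Polynomial.aeval_def]
    rfl
  have hmonic : χ.Monic := charpoly_monic _
  have hdeg : χ.natDegree = 4 := by rw [hχ, charpoly_natDegree_eq_dim, Fintype.card_fin]
  have hsep : (χ.map (Int.castRingHom ℚ)).Separable := by
    classical
    rw [← Polynomial.separable_map (algebraMap ℚ (AlgebraicClosure ℚ)), Polynomial.map_map]
    have e : (algebraMap ℚ (AlgebraicClosure ℚ)).comp (Int.castRingHom ℚ) =
      Int.castRingHom (AlgebraicClosure ℚ) := Subsingleton.elim _ _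
    rw [e]
    set P := χ.map (Int.castRingHom (AlgebraicClosure ℚ)) with hPdef
    have hPm : P.Monic := hmonic.map _
    have hPd : P.natDegree = 4 := by rw [hPdef, hmonic.natDegree_map, hdeg]
    rw [← Polynomial.nodup_roots_iff_of_splits hPm.ne_zero (IsAlgClosed.splits _),
      ← Multiset.dedup_card_eq_card_iff_nodup]
    refine le_antisymm (Multiset.card_le_card (Multiset.dedup_le _)) ?_
    refine (Polynomial.card_roots' P).trans ?_
    rw [hPd, ← hcard]
    change _ ≤ P.roots.toFinset.card
    have himg : (fun μ => ((Q.b.det : ℤ) : AlgebraicClosure ℚ) ^ 2 * μ) '' Q.discrEigenvalues ⊆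
        (P.roots.toFinset : Set (AlgebraicClosure ℚ)) := by
      rintro _ ⟨μ, hμ, rfl⟩
      simpa [hPm.ne_zero] using (heig μ).1 hμ
    have h := Set.ncard_le_ncard himg (Finset.finite_toSet _)
    rw [Set.ncard_coe_finset, Set.ncard_image_of_injective _
      (mul_right_injective₀ (pow_ne_zero 2 hbC))] at h
    exact h
  obtain ⟨m, hm, u, v, huv⟩ := exists_bezout_of_separable hsep
  have hχ0 : χ.eval 0 ≠ 0 := fun h => h0 <| by
    rw [heig, mul_zero, Polynomial.IsRoot]
    have := eval_map_intCast (AlgebraicClosure ℚ) χ 0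
    rw [h] at this
    simpa using this
  have hχ1 : χ.eval (-Q.b.det ^ 2) ≠ 0 := fun h => h1 <| by
    rw [heig, Polynomial.IsRoot]
    have := eval_map_intCast (AlgebraicClosure ℚ) χ (-Q.b.det ^ 2)
    rw [h] at this
    simpa using this
  -- The factor m, from an integral Bézout identity for χ and χ', keeps the roots distinct modulo p;
  -- the last two factors exclude the eigenvalues 0 and -1.
  let M : ℤ := Q.a.det * Q.b.det * m * χ.eval 0 * χ.eval (-Q.b.det ^ 2)
  have hM : M ≠ 0 := by simp [M, ha, hb, hm, hχ0, hχ1]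
  refine ⟨M.natAbs + 1, fun p hp hp0 => ?_⟩
  have hpM : ((M : ℤ) : ZMod p) ≠ 0 := fun h => by
    rw [ZMod.intCast_zmod_eq_zero_iff_dvd] at h
    have := Nat.le_of_dvd (Int.natAbs_pos.2 hM) (Int.natCast_dvd.1 h)
    omega
  simp only [M, Int.cast_mul, mul_ne_zero_iff] at hpM
  obtain ⟨⟨⟨⟨hap, hbp⟩, hmp⟩, hχ0p⟩, hχ1p⟩ := hpM
  refine ⟨hap, hbp, ?_⟩
  let F := AlgebraicClosure (ZMod p)
  have hcast : ∀ n : ℤ, ((n : ℤ) : ZMod p) ≠ 0 → ((n : ℤ) : F) ≠ 0 := fun n hn => by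
    rw [← map_intCast (algebraMap (ZMod p) F)]
    exact (map_ne_zero _).2 hn
  set P := χ.map (Int.castRingHom F) with hPdef
  have hPm : P.Monic := hmonic.map _
  have hPd : P.natDegree = 4 := by rw [hPdef, hmonic.natDegree_map, hdeg]
  have hPsep : P.Separable := by
    refine ⟨Polynomial.C ((m : F)⁻¹) * u.map (Int.castRingHom F),
      Polynomial.C ((m : F)⁻¹) * v.map (Int.castRingHom F), ?_⟩
    have h := congrArg (Polynomial.map (Int.castRingHom F)) huv
    simp only [Polynomial.map_add, Polynomial.map_mul, ← Polynomial.derivative_map, Polynomial.map_C,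
      Int.coe_castRingHom] at h
    rw [mul_assoc, mul_assoc, ← mul_add, h, ← Polynomial.C_mul, inv_mul_cancel₀ (hcast m hmp),
      Polynomial.C_1]
  have hcardF : Fintype.card (P.rootSet F) = 4 := by
    rw [Polynomial.card_rootSet_eq_natDegree hPsep (IsAlgClosed.splits _), hPd]
  let e : Fin 4 ≃ P.rootSet F := (Fintype.equivFinOfCardEq hcardF).symm
  have hbF := pow_ne_zero 2 (hcast _ hbp)
  have hroot : ∀ i, P.IsRoot (e i : F) := fun i => by
    have := (Polynomial.mem_rootSet.1 (e i).2).2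
    simpa using this
  have hval : ∀ i, ((Q.b.det : ℤ) : F) ^ 2 * ((((Q.b.det : ℤ) : F) ^ 2)⁻¹ * (e i : F)) = e i :=
    fun i => mul_inv_cancel_left₀ hbF _
  refine ⟨fun i => (((Q.b.det : ℤ) : F) ^ 2)⁻¹ * (e i : F), fun i j hij => ?_, fun i => ?_,
    fun i hi => ?_, fun i hi => ?_⟩
  · exact e.injective (Subtype.ext (mul_left_cancel₀ (inv_ne_zero hbF) hij))
  · have h := Q.aeval_intDiscr hbp ((((Q.b.det : ℤ) : F) ^ 2)⁻¹ * (e i : F))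
    rw [hval, (hroot i).eq_zero, eq_comm] at h
    exact (mul_eq_zero.1 h).resolve_left (pow_ne_zero _ (hcast _ hbp))
  · have h := hval i
    beta_reduce at hi
    rw [hi, mul_zero] at h
    have h2 := (hroot i).eq_zero
    rw [← h] at h2
    have h3 := eval_map_intCast F χ 0
    rw [Int.cast_zero, h2] at h3
    exact hcast _ hχ0p (by simpa using h3.symm)
  · have h := hval i
    beta_reduce at hi
    rw [hi] at h
    have h2 := (hroot i).eq_zero
    rw [← h] at h2
    have h3 := eval_map_intCast F χ (-Q.b.det ^ 2)
    have h4 : ((-Q.b.det ^ 2 : ℤ) : F) = ((Q.b.det : ℤ) : F) ^ 2 * -1 := by push_cast; ring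
    rw [h4, h2] at h3
    exact hcast _ hχ1p (by simpa using h3.symm)

end QuadForm

/-! ### Weyl operators and their intertwiners. -/

section Weyl

variable {p : ℕ} [hp : Fact p.Prime]

theorem sum_stdAddChar_dotProduct (b : Fin 4 → ZMod p) :
    ∑ x : Fin 4 → ZMod p, (ZMod.stdAddChar (b ⬝ᵥ x) : ℂ) = if b = 0 then (p : ℂ) ^ 4 else 0 := by
  classical
  let φ : (Fin 4 → ZMod p) →+ ZMod p :=
    { toFun := fun x => b ⬝ᵥ x
      map_zero' := dotProduct_zero b
      map_add' := dotProduct_add b }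
  have h := AddChar.sum_eq_ite ((ZMod.stdAddChar (N := p)).compAddMonoidHom φ)
  have e : (ZMod.stdAddChar (N := p)).compAddMonoidHom φ = 0 ↔ b = 0 := by
    constructor
    · intro h0
      ext i
      have h1 := DFunLike.congr_fun h0 (Pi.single i 1)
      have h2 : b ⬝ᵥ Pi.single i 1 = 0 := by
        apply ZMod.injective_stdAddChar
        rw [AddChar.map_zero_eq_one]
        exact h1
      simpa using h2
    · rintro rfl
      ext x
      simp [φ]
  simp only [e] at h
  refine h.trans ?_
  simp [ZMod.card]

/-- The symplectic form on phase space. -/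
def sympForm (v w : Fin 4 ⊕ Fin 4 → ZMod p) : ZMod p :=
  (v ∘ Sum.inl) ⬝ᵥ (w ∘ Sum.inr) - (v ∘ Sum.inr) ⬝ᵥ (w ∘ Sum.inl)

theorem sympForm_eq (v w : Fin 4 ⊕ Fin 4 → ZMod p) :
    sympForm v w = -(v ⬝ᵥ Matrix.J (Fin 4) (ZMod p) *ᵥ w) := by
  rw [Matrix.J, fromBlocks_mulVec, sympForm]
  simp only [dotProduct, Fintype.sum_sum_type, Sum.elim_inl, Sum.elim_inr]
  simp [Matrix.neg_mulVec]
  ring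

theorem sympForm_mulVec (g : Sp (ZMod p)) (v w : Fin 4 ⊕ Fin 4 → ZMod p) :
    sympForm (g.1 *ᵥ v) (g.1 *ᵥ w) = sympForm v w := by
  rw [sympForm_eq, sympForm_eq, mulVec_mulVec, dotProduct_mulVec, ← vecMul_transpose, vecMul_vecMul,
    ← mul_assoc, SymplecticGroup.mem_iff'.1 g.2, ← dotProduct_mulVec]

/-- The Weyl operators, as matrices. -/
def weyl (v : Fin 4 ⊕ Fin 4 → ZMod p) : Matrix (Fin 4 → ZMod p) (Fin 4 → ZMod p) ℂ :=
  of fun x y => if y = x - v ∘ Sum.inl then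
    ZMod.stdAddChar (-((v ∘ Sum.inr) ⬝ᵥ x) + 2⁻¹ * ((v ∘ Sum.inl) ⬝ᵥ (v ∘ Sum.inr))) else 0

theorem weyl_zero : weyl (0 : Fin 4 ⊕ Fin 4 → ZMod p) = 1 := by
  ext x y
  simp only [weyl, of_apply, one_apply, Pi.zero_comp, zero_dotProduct, sub_zero, mul_zero, neg_zero,
    add_zero, AddChar.map_zero_eq_one, eq_comm]

theorem weyl_mul_apply (v : Fin 4 ⊕ Fin 4 → ZMod p) (A : Matrix (Fin 4 → ZMod p) (Fin 4 → ZMod p) ℂ)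
    (x z : Fin 4 → ZMod p) : (weyl v * A) x z =
      ZMod.stdAddChar (-((v ∘ Sum.inr) ⬝ᵥ x) + 2⁻¹ * ((v ∘ Sum.inl) ⬝ᵥ (v ∘ Sum.inr))) *
        A (x - v ∘ Sum.inl) z := by
  simp [weyl, Matrix.mul_apply]

theorem mul_weyl_apply (v : Fin 4 ⊕ Fin 4 → ZMod p) (A : Matrix (Fin 4 → ZMod p) (Fin 4 → ZMod p) ℂ)
    (x z : Fin 4 → ZMod p) : (A * weyl v) x z = A x (z + v ∘ Sum.inl) *
      ZMod.stdAddChar (-((v ∘ Sum.inr) ⬝ᵥ (z + v ∘ Sum.inl)) +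
        2⁻¹ * ((v ∘ Sum.inl) ⬝ᵥ (v ∘ Sum.inr))) := by
  simp [weyl, Matrix.mul_apply, eq_sub_iff_add_eq]

/-- The half-phase in `weyl` makes the cocycle the symplectic form itself, so v ↦ gv respects these
relations for symplectic g. -/
theorem weyl_mul_weyl (v w : Fin 4 ⊕ Fin 4 → ZMod p) (h2 : (2 : ZMod p) ≠ 0) :
    weyl v * weyl w = (ZMod.stdAddChar (2⁻¹ * sympForm v w) : ℂ) • weyl (v + w) := by
  ext x z
  rw [weyl_mul_apply, Matrix.smul_apply, smul_eq_mul]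
  simp only [weyl, of_apply, Pi.add_comp, sub_sub, mul_ite, mul_zero, ← AddChar.map_add_eq_mul, sympForm]
  congr 2
  simp only [dotProduct_add, add_dotProduct, dotProduct_sub, mul_add, mul_sub, neg_add]
  rw [dotProduct_comm (w ∘ Sum.inl) (v ∘ Sum.inr), dotProduct_comm (w ∘ Sum.inr) (v ∘ Sum.inl)]
  field_simp
  ring

theorem conjTranspose_weyl (v : Fin 4 ⊕ Fin 4 → ZMod p) (h2 : (2 : ZMod p) ≠ 0) :
    (weyl v)ᴴ = weyl (-v) := by
  ext x y
  have e : (-v) ∘ Sum.inl = -(v ∘ Sum.inl) := rfl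
  have e' : (-v) ∘ Sum.inr = -(v ∘ Sum.inr) := rfl
  simp only [weyl, conjTranspose_apply, of_apply, e, e', sub_neg_eq_add]
  by_cases h : y = x + v ∘ Sum.inl
  · have h' : x = y - v ∘ Sum.inl := by rw [h, add_sub_cancel_right]
    rw [if_pos h, if_pos h', ← starRingEnd_apply, ← AddChar.map_neg_eq_conj]
    congr 1
    rw [h]
    simp only [dotProduct_add, neg_dotProduct, dotProduct_neg]
    rw [dotProduct_comm (v ∘ Sum.inr) (v ∘ Sum.inl)]
    field_simp
    ring
  · have h' : ¬ x = y - v ∘ Sum.inl := fun h' => h (by rw [h', sub_add_cancel])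
    rw [if_neg h, if_neg h', star_zero]

/-- Schur's lemma by hand: modulations force A to be diagonal, translations make the diagonal
constant. -/
theorem eq_smul_one_of_commute_weyl {A : Matrix (Fin 4 → ZMod p) (Fin 4 → ZMod p) ℂ}
    (h : ∀ v, weyl v * A = A * weyl v) : A = A 0 0 • 1 := by
  have hdiag : ∀ x z, x ≠ z → A x z = 0 := fun x z hxz => by
    by_contra hA
    obtain ⟨i, hi⟩ := Function.ne_iff.1 hxz
    have h1 := congrFun (congrFun (h (Sum.elim 0 (Pi.single i 1))) x) z
    rw [weyl_mul_apply, mul_weyl_apply] at h1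
    simp only [Sum.elim_comp_inl, Sum.elim_comp_inr, sub_zero, add_zero, zero_dotProduct, mul_zero,
      single_one_dotProduct] at h1
    rw [mul_comm] at h1
    exact hi (neg_injective (ZMod.injective_stdAddChar (mul_left_cancel₀ hA h1)))
  ext x z
  rw [Matrix.smul_apply, Matrix.one_apply]
  split_ifs with hxz
  · subst hxz
    have h1 := congrFun (congrFun (h (Sum.elim x 0)) x) 0
    rw [weyl_mul_apply, mul_weyl_apply] at h1
    simp only [Sum.elim_comp_inl, Sum.elim_comp_inr, sub_self, zero_add, zero_dotProduct, mul_zero,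
      dotProduct_zero, neg_zero, AddChar.map_zero_eq_one, one_mul, mul_one] at h1
    rw [← h1, smul_eq_mul, mul_one]
  · rw [hdiag x z hxz, smul_zero]

theorem sum_phaseSpace {M : Type*} [AddCommMonoid M] (f : (Fin 4 ⊕ Fin 4 → ZMod p) → M) :
    ∑ v, f v = ∑ a, ∑ b, f (Sum.elim a b) := by
  rw [← (Equiv.sumArrowEquivProdArrow (Fin 4) (Fin 4) (ZMod p)).symm.sum_comp, Fintype.sum_prod_type]
  rfl

theorem trace_weyl (v : Fin 4 ⊕ Fin 4 → ZMod p) :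
    (weyl v).trace = if v = 0 then (p : ℂ) ^ 4 else 0 := by
  by_cases ha : v ∘ Sum.inl = 0
  · have h := sum_stdAddChar_dotProduct (-(v ∘ Sum.inr))
    have e : v = 0 ↔ -(v ∘ Sum.inr) = 0 := by
      rw [neg_eq_zero]
      constructor
      · rintro rfl
        rfl
      · intro hb
        ext i
        rcases i with i | i
        · exact congrFun ha i
        · exact congrFun hb i
    simp only [e, ← h, Matrix.trace, diag_apply, weyl, of_apply, ha, sub_zero, if_true, zero_dotProduct,
      mul_zero, add_zero, neg_dotProduct]
  · have e : v ≠ 0 := by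
      rintro rfl
      exact ha rfl
    rw [if_neg e]
    refine Finset.sum_eq_zero fun x _ => ?_
    rw [diag_apply, weyl, of_apply, if_neg]
    intro h
    exact ha (sub_eq_self.1 h.symm)

/-- `A` intertwines the Weyl operators with their transforms under `g`. -/
def Intertwines (g : Sp (ZMod p)) (A : Matrix (Fin 4 → ZMod p) (Fin 4 → ZMod p) ℂ) : Prop :=
  ∀ v, weyl (g.1 *ᵥ v) * A = A * weyl v

theorem Intertwines.mul {g h : Sp (ZMod p)} {A B : Matrix (Fin 4 → ZMod p) (Fin 4 → ZMod p) ℂ}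
    (hA : Intertwines g A) (hB : Intertwines h B) : Intertwines (g * h) (A * B) := fun v => by
  have e : (g * h).1 *ᵥ v = g.1 *ᵥ (h.1 *ᵥ v) := (mulVec_mulVec v g.1 h.1).symm
  rw [e, ← mul_assoc, hA, mul_assoc, hB, mul_assoc]

theorem Intertwines.conjTranspose_mul {g : Sp (ZMod p)} (h2 : (2 : ZMod p) ≠ 0)
    {A B : Matrix (Fin 4 → ZMod p) (Fin 4 → ZMod p) ℂ}
    (hA : Intertwines g A) (hB : Intertwines g B) : Aᴴ * B = (Aᴴ * B) 0 0 • 1 := by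
  refine eq_smul_one_of_commute_weyl fun v => ?_
  have h := congrArg Matrix.conjTranspose (hA (-v))
  rw [Matrix.conjTranspose_mul, Matrix.conjTranspose_mul, conjTranspose_weyl _ h2,
    conjTranspose_weyl _ h2, mulVec_neg, neg_neg, neg_neg] at h
  rw [← mul_assoc, ← h, mul_assoc, hB, mul_assoc]

/-- Averaging M over phase space, v ↦ W(gv) M W(-v), always gives an intertwiner. It cannot vanish
for every matrix unit, since a sum of entries of these averages is Σ W(gv)₀₀ tr W(-v) = p⁴, only v =
0 contributing. -/
theorem exists_intertwiner_ne_zero (g : Sp (ZMod p)) (h2 : (2 : ZMod p) ≠ 0) :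
    ∃ A, Intertwines g A ∧ A ≠ 0 := by
  let T : Matrix (Fin 4 → ZMod p) (Fin 4 → ZMod p) ℂ → Matrix (Fin 4 → ZMod p) (Fin 4 → ZMod p) ℂ :=
    fun M => ∑ v, weyl (g.1 *ᵥ v) * M * weyl (-v)
  have hT : ∀ M, Intertwines g (T M) := fun M w => by
    simp only [T, Finset.mul_sum, Finset.sum_mul]
    refine Fintype.sum_equiv (Equiv.addLeft w) _ _ fun v => ?_
    have e1 : -(w + v) + w = -v := by abel
    have e2 : sympForm (-(w + v)) w = sympForm w v := by
      have e3 : (-(w + v)) ∘ Sum.inl = -(w ∘ Sum.inl + v ∘ Sum.inl) := rfl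
      have e4 : (-(w + v)) ∘ Sum.inr = -(w ∘ Sum.inr + v ∘ Sum.inr) := rfl
      simp only [sympForm, e3, e4, neg_dotProduct, add_dotProduct]
      rw [dotProduct_comm (w ∘ Sum.inl) (v ∘ Sum.inr), dotProduct_comm (w ∘ Sum.inr) (v ∘ Sum.inl),
        dotProduct_comm (w ∘ Sum.inl) (w ∘ Sum.inr)]
      ring
    rw [Equiv.coe_addLeft, ← mul_assoc, ← mul_assoc, weyl_mul_weyl _ _ h2, sympForm_mulVec,
      ← mulVec_add, mul_assoc _ (weyl (-(w + v))), weyl_mul_weyl _ _ h2, e1, e2, Matrix.mul_smul,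
      Matrix.smul_mul, Matrix.smul_mul]
  by_contra! H
  have hzero : ∀ j, (T (Matrix.single 0 j 1)) 0 j = 0 := fun j => by
    rw [H _ (hT _), Matrix.zero_apply]
  have hsum : ∑ j, (T (Matrix.single 0 j 1)) 0 j = 0 := Finset.sum_eq_zero fun j _ => hzero j
  have hentry : ∀ j, (T (Matrix.single 0 j 1)) 0 j =
      ∑ v, weyl (g.1 *ᵥ v) 0 0 * weyl (-v) j j := fun j => by
    simp only [T, Matrix.sum_apply]
    refine Finset.sum_congr rfl fun v _ => ?_
    rw [mul_assoc, Matrix.mul_apply, Finset.sum_eq_single 0]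
    · simp
    · intro i _ hi
      rw [Matrix.single_mul_apply_of_ne _ _ _ _ _ hi, mul_zero]
    · simp
  simp only [hentry] at hsum
  rw [Finset.sum_comm] at hsum
  simp only [← Finset.mul_sum] at hsum
  have htr : ∀ v : Fin 4 ⊕ Fin 4 → ZMod p, ∑ j, weyl (-v) j j = if v = 0 then (p : ℂ) ^ 4 else 0 :=
    fun v => (trace_weyl (-v)).trans (by simp only [neg_eq_zero])
  simp only [htr, mul_ite, mul_zero] at hsum
  rw [Finset.sum_ite_eq' Finset.univ, if_pos (Finset.mem_univ _), mulVec_zero, weyl_zero, one_apply_eq, one_mul] at hsum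
  exact pow_ne_zero 4 (Nat.cast_ne_zero.2 hp.out.ne_zero) hsum

-- For an intertwiner A, AᴴA is a scalar, the squared norm of a column, so A becomes unitary after
-- division by a square root.
open ComplexOrder in
theorem exists_unitary_intertwiner (g : Sp (ZMod p)) (h2 : (2 : ZMod p) ≠ 0) :
    ∃ U ∈ Matrix.unitaryGroup (Fin 4 → ZMod p) ℂ, Intertwines g U := by
  obtain ⟨A, hA, hA0⟩ := exists_intertwiner_ne_zero g h2
  have h := hA.conjTranspose_mul h2 hA
  set r : ℝ := ∑ y, ‖A y 0‖ ^ 2 with hr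
  have hc : (Aᴴ * A) 0 0 = (r : ℂ) := by
    rw [Matrix.mul_apply, hr, Complex.ofReal_sum]
    refine Finset.sum_congr rfl fun y _ => ?_
    rw [conjTranspose_apply, ← starRingEnd_apply, Complex.conj_mul']
    simp
  rw [hc] at h
  have hr0 : r ≠ 0 := fun h0 => hA0 <| by
    rw [h0, Complex.ofReal_zero, zero_smul] at h
    exact conjTranspose_mul_self_eq_zero.1 h
  have hrpos : 0 < r := lt_of_le_of_ne (Finset.sum_nonneg fun _ _ => by positivity) hr0.symm
  refine ⟨((Real.sqrt r)⁻¹ : ℂ) • A, ?_, fun v => ?_⟩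
  · rw [Matrix.mem_unitaryGroup_iff', star_eq_conjTranspose, conjTranspose_smul, Matrix.smul_mul, Matrix.mul_smul, h,
      smul_smul, smul_smul]
    have : star ((Real.sqrt r : ℂ)⁻¹) * (Real.sqrt r : ℂ)⁻¹ * r = 1 := by
      rw [← starRingEnd_apply, map_inv₀, Complex.conj_ofReal, ← mul_inv, ← Complex.ofReal_mul,
        Real.mul_self_sqrt hrpos.le, inv_mul_cancel₀ (Complex.ofReal_ne_zero.2 hr0)]
    rw [this, one_smul]
  · rw [Matrix.mul_smul, hA, Matrix.smul_mul]

theorem Intertwines.exists_eq_smul {g : Sp (ZMod p)} (h2 : (2 : ZMod p) ≠ 0)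
    {U V : Matrix (Fin 4 → ZMod p) (Fin 4 → ZMod p) ℂ}
    (hU : U ∈ Matrix.unitaryGroup (Fin 4 → ZMod p) ℂ) (hV : V ∈ Matrix.unitaryGroup (Fin 4 → ZMod p) ℂ)
    (hgU : Intertwines g U) (hgV : Intertwines g V) : ∃ z : Circle, V = (z : ℂ) • U := by
  have h := hgU.conjTranspose_mul h2 hgV
  set c := (Uᴴ * V) 0 0
  have hVU : V = c • U := by
    rw [← one_mul V, ← Matrix.mem_unitaryGroup_iff.1 hU, star_eq_conjTranspose, mul_assoc, h,
      Matrix.mul_smul, mul_one]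
  have hc : star c * c = 1 := by
    have h1 := Matrix.mem_unitaryGroup_iff'.1 hV
    rw [hVU, star_eq_conjTranspose, conjTranspose_smul, Matrix.smul_mul, Matrix.mul_smul,
      ← star_eq_conjTranspose, Matrix.mem_unitaryGroup_iff'.1 hU, smul_smul] at h1
    have h3 := congrFun (congrFun h1 0) 0
    simpa using h3
  refine ⟨⟨c, ?_⟩, hVU⟩
  refine mem_sphere_zero_iff_norm.2 ?_
  have h3 : ((‖c‖ : ℂ)) ^ 2 = 1 := by rw [← Complex.conj_mul']; exact hc
  have h4 : ‖c‖ ^ 2 = 1 := by exact_mod_cast h3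
  exact (pow_eq_one_iff_of_nonneg (norm_nonneg _) two_ne_zero).1 h4

end Weyl

/-! ### Determinants on the range of an idempotent. -/

section Idempotent

variable {n : Type*} [Fintype n] [DecidableEq n]

/-- The determinant of `A` on the range of an idempotent `E` commuting with it. -/
def detOn (E A : Matrix n n ℂ) : ℂ := (A * E + (1 - E)).det

theorem detOn_mul {E A B : Matrix n n ℂ} (hE : E * E = E) (hB : E * B = B * E) :
    detOn E (A * B) = detOn E A * detOn E B := by
  rw [detOn, detOn, detOn, ← det_mul]
  congr 1
  have h1 : E * (B * E) = B * E := by rw [← mul_assoc, hB, mul_assoc, hE]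
  simp only [mul_add, add_mul, mul_sub, sub_mul, mul_one, one_mul, mul_assoc, hE, h1]
  abel

theorem detOn_one (E : Matrix n n ℂ) : detOn E 1 = 1 := by
  rw [detOn, one_mul, add_sub_cancel, det_one]

/-- The exponent is the rank of E: on range ⊕ kernel the operator is c on the first summand and 1 on
the second. -/
theorem exists_trace_eq_and_detOn_smul_one {E : Matrix n n ℂ} (hE : E * E = E) :
    ∃ k : ℕ, E.trace = k ∧ ∀ c : ℂ, detOn E (c • 1) = c ^ k := by
  have hf : IsIdempotentElem (toLin' E) := by
    rw [IsIdempotentElem, Module.End.mul_eq_comp, ← toLin'_mul, hE]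
  have hp := (LinearMap.isProj_range_iff_isIdempotentElem _).2 hf
  refine ⟨Module.finrank ℂ (LinearMap.range (toLin' E)), ?_, fun c => ?_⟩
  · rw [← hp.trace, trace_toLin'_eq]
  · set f := toLin' E with hf'
    let e := (LinearMap.range f).prodEquivOfIsCompl (LinearMap.ker f) hp.isCompl
    have h : toLin' (c • 1 * E + (1 - E)) = 
        e.conj (LinearMap.prodMap (c • LinearMap.id : LinearMap.range f →ₗ[ℂ] LinearMap.range f)
          (LinearMap.id : LinearMap.ker f →ₗ[ℂ] LinearMap.ker f)) := by
      have h1 : f = e.conj (LinearMap.prodMap LinearMap.id 0) := hp.eq_conj_prodMap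
      have h2 : LinearMap.prodMap (c • LinearMap.id : LinearMap.range f →ₗ[ℂ] LinearMap.range f)
          (LinearMap.id : LinearMap.ker f →ₗ[ℂ] LinearMap.ker f) +
            LinearMap.prodMap (LinearMap.id : LinearMap.range f →ₗ[ℂ] LinearMap.range f)
              (0 : LinearMap.ker f →ₗ[ℂ] LinearMap.ker f) =
          c • LinearMap.prodMap (LinearMap.id : LinearMap.range f →ₗ[ℂ] LinearMap.range f)
            (0 : LinearMap.ker f →ₗ[ℂ] LinearMap.ker f) + LinearMap.id := by
        ext <;> simp
      have h3 := congrArg e.conj h2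
      rw [map_add, map_add, map_smul, ← h1, LinearEquiv.conj_id] at h3
      apply add_right_cancel (b := f)
      rw [h3, Matrix.smul_mul, one_mul, hf', ← map_add, add_assoc, sub_add_cancel, map_add,
        map_smul, toLin'_one]
    rw [detOn, ← LinearMap.det_toLin', h, LinearEquiv.conj_apply, LinearMap.comp_assoc,
      LinearMap.det_conj, LinearMap.det_prodMap, LinearMap.det_smul, LinearMap.det_id,
      LinearMap.det_id, mul_one, mul_one]

theorem star_detOn {E A : Matrix n n ℂ} (hE : Eᴴ = E) (hA : E * A = A * E) :
    star (detOn E A) = detOn E Aᴴ := by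
  have h : Eᴴ * Aᴴ = Aᴴ * Eᴴ := by
    rw [← conjTranspose_mul, ← conjTranspose_mul, hA]
  rw [detOn, detOn, ← det_conjTranspose, conjTranspose_add, conjTranspose_sub, conjTranspose_mul,
    conjTranspose_one, h, hE]

theorem norm_detOn {E U : Matrix n n ℂ} (hE : E * E = E) (hE' : Eᴴ = E) (hU : U ∈ unitaryGroup n ℂ)
    (hEU : E * U = U * E) : ‖detOn E U‖ = 1 := by
  have h := detOn_mul (A := Uᴴ) hE hEU
  rw [← star_eq_conjTranspose U, mem_unitaryGroup_iff'.1 hU, detOn_one, star_eq_conjTranspose,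
    ← star_detOn hE' hEU, ← starRingEnd_apply, Complex.conj_mul'] at h
  have h4 : ‖detOn E U‖ ^ 2 = 1 := by exact_mod_cast h.symm
  exact (pow_eq_one_iff_of_nonneg (norm_nonneg _) two_ne_zero).1 h4

end Idempotent

/-! ### Fixing the phase by even and odd determinants. -/

section Parity

variable (p : ℕ) [hp : Fact p.Prime]

/-- The matrix of `f ↦ f(-x)`. -/
def parity : Matrix (Fin 4 → ZMod p) (Fin 4 → ZMod p) ℂ := of fun x y => if y = -x then 1 else 0

variable {p}

theorem sum_weyl (h2 : (2 : ZMod p) ≠ 0) : ∑ v, weyl (p := p) v = (p : ℂ) ^ 4 • parity p := by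
  ext x y
  rw [Matrix.sum_apply, sum_phaseSpace, Finset.sum_comm]
  have e : ∀ a : Fin 4 → ZMod p, y = x - a ↔ a = x - y := fun a =>
    ⟨fun h => by rw [h, sub_sub_cancel], fun h => by rw [h, sub_sub_cancel]⟩
  have h := sum_stdAddChar_dotProduct (p := p) (-x + (2⁻¹ : ZMod p) • (x - y))
  have e' : -x + (2⁻¹ : ZMod p) • (x - y) = 0 ↔ y = -x := by
    constructor
    · intro h
      have h' : (2 : ZMod p) • (-x + (2⁻¹ : ZMod p) • (x - y)) = 0 := by rw [h, smul_zero]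
      rw [smul_add, smul_smul, mul_inv_cancel₀ h2, one_smul, two_smul] at h'
      linear_combination (exp := 1) -h'
    · rintro rfl
      rw [sub_neg_eq_add, ← two_smul (ZMod p) x, smul_smul, inv_mul_cancel₀ h2, one_smul,
        neg_add_cancel]
  simp only [weyl, of_apply, Sum.elim_comp_inl, Sum.elim_comp_inr, e, Finset.sum_ite_eq',
    Finset.mem_univ, if_true]
  rw [Matrix.smul_apply, parity, of_apply, smul_eq_mul, mul_ite, mul_one, mul_zero]
  simp only [e'] at h
  rw [← h]
  refine Finset.sum_congr rfl fun b _ => ?_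
  rw [add_dotProduct, neg_dotProduct, smul_dotProduct, smul_eq_mul, dotProduct_comm b x]

/-- Parity is, up to p⁴, the sum of all Weyl operators, and g merely permutes that sum. -/
theorem Intertwines.parity_mul {g : Sp (ZMod p)} (h2 : (2 : ZMod p) ≠ 0)
    {A : Matrix (Fin 4 → ZMod p) (Fin 4 → ZMod p) ℂ} (hA : Intertwines g A) :
    parity p * A = A * parity p := by
  have hu : IsUnit g.1.det := SymplecticGroup.symplectic_det g.2
  have hbij : Function.Bijective (fun v : Fin 4 ⊕ Fin 4 → ZMod p => g.1 *ᵥ v) :=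
    Function.bijective_iff_has_inverse.2 ⟨fun v => g.1⁻¹ *ᵥ v,
      fun v => by simp only [mulVec_mulVec, nonsing_inv_mul _ hu, one_mulVec],
      fun v => by simp only [mulVec_mulVec, mul_nonsing_inv _ hu, one_mulVec]⟩
  have h : (∑ v, weyl (p := p) (g.1 *ᵥ v)) * A = A * ∑ v, weyl (p := p) v := by
    rw [Finset.sum_mul, Finset.mul_sum]
    exact Finset.sum_congr rfl fun v _ => hA v
  rw [hbij.sum_comp (weyl (p := p))] at h
  rw [sum_weyl h2, Matrix.smul_mul, Matrix.mul_smul] at h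
  exact smul_right_injective _ (pow_ne_zero 4 (Nat.cast_ne_zero.2 hp.out.ne_zero)) h

theorem parity_mul_parity : parity p * parity p = 1 := by
  ext x y
  rw [Matrix.mul_apply, Finset.sum_eq_single (-x) (fun j _ hj => by simp [parity, hj])
    (fun h => absurd (Finset.mem_univ _) h)]
  simp [parity, Matrix.one_apply, eq_comm]

theorem conjTranspose_parity : (parity p)ᴴ = parity p := by
  ext x y
  simp only [parity, conjTranspose_apply, of_apply, apply_ite star, star_one, star_zero]
  simp only [eq_neg_iff_add_eq_zero, add_comm]

theorem trace_parity (h2 : (2 : ZMod p) ≠ 0) : (parity p).trace = 1 := by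
  have e : ∀ x : Fin 4 → ZMod p, x = -x ↔ x = 0 := fun x => by
    rw [eq_neg_iff_add_eq_zero, ← two_smul (ZMod p) x, smul_eq_zero_iff_right h2]
  simp [parity, Matrix.trace, e]

variable (p) in
/-- The projections to even and odd functions, for `t = 1` and `t = -1`. -/
def parityProj (t : ℤˣ) : Matrix (Fin 4 → ZMod p) (Fin 4 → ZMod p) ℂ :=
  (2⁻¹ : ℂ) • (1 + ((t : ℤ) : ℂ) • parity p)

theorem parityProj_mul_self (t : ℤˣ) : parityProj p t * parityProj p t = parityProj p t := by
  have ht : ((t : ℤ) : ℂ) * ((t : ℤ) : ℂ) = 1 := by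
    rcases Int.units_eq_one_or t with rfl | rfl <;> simp
  simp only [parityProj, Matrix.smul_mul, Matrix.mul_smul, add_mul, mul_add, one_mul, mul_one,
    parity_mul_parity, smul_add, smul_smul]
  have h : (2⁻¹ : ℂ) * ((t : ℤ) : ℂ) * (2⁻¹ * ((t : ℤ) : ℂ)) = 2⁻¹ * 2⁻¹ := by
    rw [mul_mul_mul_comm, ht, mul_one]
  rw [h]
  module

theorem conjTranspose_parityProj (t : ℤˣ) : (parityProj p t)ᴴ = parityProj p t := by
  simp [parityProj, conjTranspose_smul, conjTranspose_parity]

theorem Intertwines.parityProj_mul {g : Sp (ZMod p)} (h2 : (2 : ZMod p) ≠ 0)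
    {A : Matrix (Fin 4 → ZMod p) (Fin 4 → ZMod p) ℂ} (hA : Intertwines g A) (t : ℤˣ) :
    parityProj p t * A = A * parityProj p t := by
  simp only [parityProj, Matrix.smul_mul, Matrix.mul_smul, add_mul, mul_add, one_mul, mul_one,
    hA.parity_mul h2]

/-- The quotient of the determinants of an operator on even and on odd functions. -/
def detRatio (A : Matrix (Fin 4 → ZMod p) (Fin 4 → ZMod p) ℂ) : ℂ :=
  detOn (parityProj p 1) A / detOn (parityProj p (-1)) A

/-- The even and odd ranks differ by the trace of parity, which is 1. The ratio therefore sees a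
scalar to the first power and can normalise it away. -/
theorem detRatio_smul_one (h2 : (2 : ZMod p) ≠ 0) {c : ℂ} (hc : c ≠ 0) :
    detRatio (p := p) (c • 1) = c := by
  obtain ⟨k, hk, hk'⟩ := exists_trace_eq_and_detOn_smul_one (parityProj_mul_self (p := p) 1)
  obtain ⟨m, hm, hm'⟩ := exists_trace_eq_and_detOn_smul_one (parityProj_mul_self (p := p) (-1))
  have h : (k : ℂ) = m + 1 := by
    rw [← hk, ← hm]
    simp only [parityProj, trace_smul, trace_add, trace_parity h2, smul_eq_mul, Units.val_one,
      Units.val_neg, Int.cast_one, Int.cast_neg]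
    ring
  have h' : k = m + 1 := by exact_mod_cast h
  rw [detRatio, hk', hm', h', pow_succ, mul_div_cancel_left₀ _ (pow_ne_zero _ hc)]

theorem Intertwines.detRatio_mul {g : Sp (ZMod p)} (h2 : (2 : ZMod p) ≠ 0)
    (A : Matrix (Fin 4 → ZMod p) (Fin 4 → ZMod p) ℂ)
    {B : Matrix (Fin 4 → ZMod p) (Fin 4 → ZMod p) ℂ} (hB : Intertwines g B) :
    detRatio (A * B) = detRatio A * detRatio B := by
  rw [detRatio, detOn_mul (parityProj_mul_self _) (hB.parityProj_mul h2 _),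
    detOn_mul (parityProj_mul_self _) (hB.parityProj_mul h2 _), mul_div_mul_comm, detRatio, detRatio]

theorem Intertwines.detRatio_smul {g : Sp (ZMod p)} (h2 : (2 : ZMod p) ≠ 0)
    {A : Matrix (Fin 4 → ZMod p) (Fin 4 → ZMod p) ℂ} (hA : Intertwines g A) {c : ℂ} (hc : c ≠ 0) :
    detRatio (c • A) = c * detRatio A := by
  rw [← detRatio_smul_one h2 hc, ← hA.detRatio_mul h2, Matrix.smul_mul, one_mul,
    detRatio_smul_one h2 hc]

theorem Intertwines.norm_detRatio {g : Sp (ZMod p)} (h2 : (2 : ZMod p) ≠ 0)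
    {U : Matrix (Fin 4 → ZMod p) (Fin 4 → ZMod p) ℂ}
    (hU : U ∈ Matrix.unitaryGroup (Fin 4 → ZMod p) ℂ) (hgU : Intertwines g U) :
    ‖detRatio U‖ = 1 := by
  rw [detRatio, norm_div, norm_detOn (parityProj_mul_self _) (conjTranspose_parityProj _) hU
    (hgU.parityProj_mul h2 _), norm_detOn (parityProj_mul_self _) (conjTranspose_parityProj _) hU
    (hgU.parityProj_mul h2 _), div_one]

theorem exists_normalized_intertwiner (g : Sp (ZMod p)) (h2 : (2 : ZMod p) ≠ 0) :
    ∃ U : Matrix.unitaryGroup (Fin 4 → ZMod p) ℂ, Intertwines g U.1 ∧ detRatio U.1 = 1 := by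
  obtain ⟨U, hU, hgU⟩ := exists_unitary_intertwiner g h2
  have hn := hgU.norm_detRatio h2 hU
  have h0 : detRatio U ≠ 0 := fun h => by simp [h] at hn
  refine ⟨⟨(detRatio U)⁻¹ • U, ?_⟩, fun v => ?_, ?_⟩
  · rw [mem_unitaryGroup_iff', star_eq_conjTranspose, conjTranspose_smul, Matrix.smul_mul,
      Matrix.mul_smul, ← star_eq_conjTranspose, mem_unitaryGroup_iff'.1 hU, smul_smul,
      ← starRingEnd_apply, Complex.conj_mul', norm_inv, hn]
    simp
  · rw [Matrix.mul_smul, hgU, Matrix.smul_mul]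
  · rw [hgU.detRatio_smul h2 (inv_ne_zero h0), inv_mul_cancel₀ h0]

theorem Intertwines.eq_of_detRatio {g : Sp (ZMod p)} (h2 : (2 : ZMod p) ≠ 0)
    {U V : Matrix.unitaryGroup (Fin 4 → ZMod p) ℂ} (hU : Intertwines g U.1) (hV : Intertwines g V.1)
    (hU1 : detRatio U.1 = 1) (hV1 : detRatio V.1 = 1) : U = V := by
  obtain ⟨z, hz⟩ := hU.exists_eq_smul h2 U.2 V.2 hV
  rw [hz, hU.detRatio_smul h2 z.coe_ne_zero, hU1, mul_one] at hV1
  rw [hV1, one_smul] at hz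
  exact Subtype.ext hz.symm

/-- Normalised intertwiners are unique and closed under products, so the projective representation
is an honest one. -/
theorem exists_weilHom (h2 : (2 : ZMod p) ≠ 0) :
    ∃ U : Sp (ZMod p) →* Matrix.unitaryGroup (Fin 4 → ZMod p) ℂ, ∀ g, Intertwines g (U g).1 := by
  choose U hU hU1 using fun g : Sp (ZMod p) => exists_normalized_intertwiner g h2
  refine ⟨MonoidHom.mk' U fun g h => ?_, hU⟩
  refine (hU (g * h)).eq_of_detRatio (V := U g * U h) h2 ((hU g).mul (hU h)) (hU1 _) ?_
  change detRatio ((U g).1 * (U h).1) = 1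
  rw [(hU h).detRatio_mul h2, hU1, hU1, one_mul]

end Parity

/-! ### Explicit intertwiners and existence of a Weil representation. -/

section Existence

variable {p : ℕ} [hp : Fact p.Prime]

/-- The unitary operator with a given unitary matrix. -/
def unitaryOperator : Matrix.unitaryGroup (Fin 4 → ZMod p) ℂ →* (L2 p ≃ₗᵢ[ℂ] L2 p) :=
  Unitary.linearIsometryEquiv.toMonoidHom.comp
    (Unitary.map
      { toFun := Matrix.toEuclideanCLM (n := Fin 4 → ZMod p) (𝕜 := ℂ)
        map_one' := map_one _
        map_mul' := map_mul _
        map_star' := map_star _ }).toMonoidHom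

theorem unitaryOperator_apply (U : Matrix.unitaryGroup (Fin 4 → ZMod p) ℂ) (f : L2 p)
    (x : Fin 4 → ZMod p) : unitaryOperator U f x = ∑ y, U.1 x y * f y := rfl

/-- AᴴA is already a scalar, so the norm of one column decides unitarity. -/
theorem Intertwines.mem_unitaryGroup {g : Sp (ZMod p)} (h2 : (2 : ZMod p) ≠ 0)
    {A : Matrix (Fin 4 → ZMod p) (Fin 4 → ZMod p) ℂ} (hA : Intertwines g A)
    (h : ∑ y, star (A y 0) * A y 0 = 1) : A ∈ Matrix.unitaryGroup (Fin 4 → ZMod p) ℂ := by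
  have h1 := hA.conjTranspose_mul h2 hA
  have h3 : (Aᴴ * A) 0 0 = 1 := h
  rw [mem_unitaryGroup_iff', star_eq_conjTranspose, h1, h3, one_smul]

/-- The matrix of the Fourier transform. -/
def fourierMatrix : Matrix (Fin 4 → ZMod p) (Fin 4 → ZMod p) ℂ :=
  of fun x y => (p : ℂ) ^ 2 / (p : ℂ) ^ 4 * ZMod.stdAddChar (x ⬝ᵥ y)

theorem intertwines_fourierMatrix (h2 : (2 : ZMod p) ≠ 0) :
    Intertwines J (fourierMatrix (p := p)) := fun v => by
  have e1 : (J (R := ZMod p)).1 *ᵥ v = Sum.elim (v ∘ Sum.inr) (-(v ∘ Sum.inl)) := by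
    rw [J, fromBlocks_mulVec]
    simp [Matrix.neg_mulVec]
  ext x z
  rw [weyl_mul_apply, mul_weyl_apply, e1]
  simp only [Sum.elim_comp_inl, Sum.elim_comp_inr, fourierMatrix, of_apply]
  rw [mul_left_comm, mul_assoc, ← AddChar.map_add_eq_mul, ← AddChar.map_add_eq_mul]
  congr 2
  simp only [neg_dotProduct, dotProduct_neg, sub_dotProduct, dotProduct_add]
  rw [dotProduct_comm (v ∘ Sum.inr) (v ∘ Sum.inl), dotProduct_comm x (v ∘ Sum.inl)]
  field_simp
  ring

theorem fourierMatrix_mem (h2 : (2 : ZMod p) ≠ 0) :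
    fourierMatrix (p := p) ∈ Matrix.unitaryGroup (Fin 4 → ZMod p) ℂ := by
  refine (intertwines_fourierMatrix h2).mem_unitaryGroup h2 ?_
  have hp0 : (p : ℂ) ≠ 0 := Nat.cast_ne_zero.2 hp.out.ne_zero
  simp only [fourierMatrix, of_apply, dotProduct_zero, AddChar.map_zero_eq_one, mul_one]
  simp [ZMod.card]
  field_simp

/-- The intertwiner of a block lower triangular element. -/
def lowerMatrix (g : Sp (ZMod p)) : Matrix (Fin 4 → ZMod p) (Fin 4 → ZMod p) ℂ :=
  of fun x y => if y = g.1.toBlocks₂₂ᵀ *ᵥ x then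
    ZMod.stdAddChar (-2⁻¹ * (x ⬝ᵥ (g.1.toBlocks₂₁ * g.1.toBlocks₂₂ᵀ) *ᵥ x)) else 0

theorem lower_mul_transpose {g : Sp (ZMod p)} (hg : g.1.toBlocks₁₂ = 0) :
    g.1.toBlocks₁₁ * g.1.toBlocks₂₂ᵀ = 1 := by
  have h := g.2
  rw [← fromBlocks_toBlocks g.1, SymplecticGroup.fromBlocks_mem_iff] at h
  have h3 := congrArg transpose h.2.2
  rw [hg, Matrix.mul_zero, sub_zero, transpose_mul, transpose_transpose, transpose_one] at h3
  exact mul_eq_one_comm.1 h3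

theorem intertwines_lowerMatrix {g : Sp (ZMod p)} (hg : g.1.toBlocks₁₂ = 0)
    (h2 : (2 : ZMod p) ≠ 0) : Intertwines g (lowerMatrix g) := fun v => by
  have hAD := lower_mul_transpose hg
  have hDA := mul_eq_one_comm.1 hAD
  have hs : g.1.toBlocks₁₁ᵀ * g.1.toBlocks₂₁ = g.1.toBlocks₂₁ᵀ * g.1.toBlocks₁₁ := by
    have h := g.2
    rw [← fromBlocks_toBlocks g.1, SymplecticGroup.fromBlocks_mem_iff] at h
    exact h.1
  have e1 : g.1 *ᵥ v = Sum.elim (g.1.toBlocks₁₁ *ᵥ (v ∘ Sum.inl))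
      (g.1.toBlocks₂₁ *ᵥ (v ∘ Sum.inl) + g.1.toBlocks₂₂ *ᵥ (v ∘ Sum.inr)) := by
    conv_lhs => rw [← fromBlocks_toBlocks g.1, fromBlocks_mulVec, hg, zero_mulVec, add_zero]
  ext x z
  rw [weyl_mul_apply, mul_weyl_apply, e1]
  simp only [Sum.elim_comp_inl, Sum.elim_comp_inr, lowerMatrix, of_apply]
  generalize v ∘ Sum.inl = a
  generalize v ∘ Sum.inr = b
  generalize g.1.toBlocks₁₁ = A at *
  generalize g.1.toBlocks₂₁ = C at *
  generalize g.1.toBlocks₂₂ = D at *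
  have hz : z = Dᵀ *ᵥ (x - A *ᵥ a) ↔ z + a = Dᵀ *ᵥ x := by
    rw [mulVec_sub, mulVec_mulVec, hDA, one_mulVec, eq_sub_iff_add_eq]
  simp only [hz]
  split_ifs with h
  · rw [← AddChar.map_add_eq_mul, ← AddChar.map_add_eq_mul, h]
    congr 1
    have i1 : (C * Dᵀ) *ᵥ (x - A *ᵥ a) = (C * Dᵀ) *ᵥ x - C *ᵥ a := by
      rw [mulVec_sub, mulVec_mulVec, mul_assoc, hDA, mul_one]
    have i2 : (A *ᵥ a) ⬝ᵥ (C * Dᵀ) *ᵥ x = (C *ᵥ a) ⬝ᵥ x := by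
      rw [← vecMul_transpose, ← dotProduct_mulVec, mulVec_mulVec, ← mul_assoc, hs, mul_assoc, hAD,
        mul_one, dotProduct_mulVec, vecMul_transpose]
    have i3 : (A *ᵥ a) ⬝ᵥ (D *ᵥ b) = a ⬝ᵥ b := by
      have h5 : Aᵀ * D = 1 := by
        rw [← transpose_transpose D, ← transpose_mul, hDA, transpose_one]
      rw [← vecMul_transpose, ← dotProduct_mulVec, mulVec_mulVec, h5, one_mulVec]
    have i4 : (D *ᵥ b) ⬝ᵥ x = b ⬝ᵥ Dᵀ *ᵥ x := by
      rw [dotProduct_mulVec, vecMul_transpose]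
    rw [i1]
    simp only [sub_dotProduct, dotProduct_sub, add_dotProduct, dotProduct_add, i2, i3, i4]
    rw [dotProduct_comm x (C *ᵥ a)]
    field_simp
    ring
  · rw [mul_zero, zero_mul]

theorem lowerMatrix_mem {g : Sp (ZMod p)} (hg : g.1.toBlocks₁₂ = 0) (h2 : (2 : ZMod p) ≠ 0) :
    lowerMatrix g ∈ Matrix.unitaryGroup (Fin 4 → ZMod p) ℂ := by
  refine (intertwines_lowerMatrix hg h2).mem_unitaryGroup h2 ?_
  rw [Finset.sum_eq_single 0]
  · simp [lowerMatrix]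
  · intro y _ hy
    have h : ¬ 0 = g.1.toBlocks₂₂ᵀ *ᵥ y := fun h => hy <| by
      rw [← one_mulVec y, ← lower_mul_transpose hg, ← mulVec_mulVec, ← h, mulVec_zero]
    simp [lowerMatrix, h]
  · exact fun h => absurd (Finset.mem_univ _) h

theorem exists_isWeilRep (h2 : (2 : ZMod p) ≠ 0) : ∃ ρ : UnitaryRep p, IsWeilRep p ρ := by
  obtain ⟨U, hU⟩ := exists_weilHom h2
  -- The two clauses never compete, because the upper right block of J is nonzero; for all other
  -- elements the phase is arbitrary and set to 1.
  have hξ : ∀ g : Sp (ZMod p), ∃ z : Circle,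
      (g.1.toBlocks₁₂ = 0 → (U g).1 = (z : ℂ) • lowerMatrix g) ∧
        (g = J → (U g).1 = (z : ℂ) • fourierMatrix) := fun g => by
    by_cases hg : g.1.toBlocks₁₂ = 0
    · obtain ⟨z, hz⟩ := (intertwines_lowerMatrix hg h2).exists_eq_smul h2 (lowerMatrix_mem hg h2)
        (U g).2 (hU g)
      refine ⟨z, fun _ => hz, ?_⟩
      rintro rfl
      simp [J] at hg
    · by_cases hJ : g = J
      · subst hJ
        obtain ⟨z, hz⟩ := (intertwines_fourierMatrix h2).exists_eq_smul h2 (fourierMatrix_mem h2)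
          (U J).2 (hU J)
        exact ⟨z, fun h => absurd h hg, fun _ => hz⟩
      · exact ⟨1, fun h => absurd h hg, fun h => absurd h hJ⟩
  choose ξ hξ1 hξ2 using hξ
  have happ : ∀ (g : Sp (ZMod p)) (M : Matrix (Fin 4 → ZMod p) (Fin 4 → ZMod p) ℂ),
      (U g).1 = (ξ g : ℂ) • M → ∀ (f : L2 p) (x : Fin 4 → ZMod p),
        unitaryOperator (U g) f x = (ξ g : ℂ) * ∑ y, M x y * f y := fun g M h f x => by
    rw [unitaryOperator_apply, h, Finset.mul_sum]
    exact Finset.sum_congr rfl fun y _ => by rw [Matrix.smul_apply, smul_eq_mul, mul_assoc]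
  refine ⟨unitaryOperator.comp U, ξ, fun E f x => ?_, fun f x => ?_, fun W hW f x => ?_⟩
  · refine (happ _ _ (hξ1 (s E) (by simp [s])) f x).trans ?_
    simp [lowerMatrix, s]
  · refine (happ _ _ (hξ2 J rfl) f x).trans ?_
    congr 1
    rw [Finset.sum_div, Finset.mul_sum]
    exact Finset.sum_congr rfl fun y _ => by
      rw [fourierMatrix, of_apply]
      ring
  · refine (happ _ _ (hξ1 (l W hW) (by simp [l])) f x).trans ?_
    simp [lowerMatrix, l]

end Existence

end Sp8

end

theorem proposition11p1 (Q : Sp8.QuadForm) (hQ : Q.IsGeneric) :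
    ∃ p₀ : ℕ, ∀ (p : ℕ) [Fact p.Prime], p₀ ≤ p →
      ∃ hb : IsUnit (Q.b.map (Int.cast : ℤ → ZMod p)).det,
        (∃ ρ : Sp8.UnitaryRep p, Sp8.IsWeilRep p ρ) ∧
        ∀ ρ : Sp8.UnitaryRep p, Sp8.IsWeilRep p ρ →
          ∀ (r : (ZMod p)ˣ) (f : Sp8.L2 p),
            (∀ γ ∈ Q.Gamma p hb, ρ.twist r γ f = f) → f = 0 := by
  obtain ⟨p₀, h⟩ := hQ.exists_prime_bound
  -- The second bound is what the counting of lower unipotents needs.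
  refine ⟨max p₀ (96 ^ 12 + 1), fun p _ hp => ?_⟩
  obtain ⟨ha, hb, μ, hμ, hroot, hμ0, hμ1⟩ := h p ((le_max_left _ _).trans hp)
  have hp1 : 96 ^ 12 < p := (le_max_right _ _).trans hp
  have hdet : ∀ m : Matrix (Fin 4) (Fin 4) ℤ,
      (m.map (Int.cast : ℤ → ZMod p)).det = ((m.det : ℤ) : ZMod p) := fun m =>
    ((Int.castRingHom (ZMod p)).map_det m).symm
  have hb' : IsUnit (Q.b.map (Int.cast : ℤ → ZMod p)).det := by
    rw [hdet]
    exact isUnit_iff_ne_zero.2 hb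
  have h2 : (2 : ZMod p) ≠ 0 := fun h0 => by
    have h3 : ((2 : ℕ) : ZMod p) = 0 := by exact_mod_cast h0
    have := Nat.le_of_dvd two_pos ((ZMod.natCast_eq_zero_iff 2 p).1 h3)
    norm_num at hp1
    omega
  refine ⟨hb', Sp8.exists_isWeilRep h2, fun ρ hρ r f hf => ?_⟩
  exact Sp8.eq_zero_of_twist_invariant hp1 (Q.a_symm.map _) (Q.c_symm.map _) ((hdet Q.a).trans_ne ha) hb' hμ
    hroot hμ0 hμ1 hρ r f hf
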